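/- Let $\mathsf k$ be a field with $\operatorname{char}\mathsf k\neq 2$ and let $n\ge 1$. Let $R=\mathsf k[x_{ij}: 1\le i<j\le 2n]$ and $S=\mathsf k[y_{ij}: 1\le i<j\le 2n]$, with $S$ acting on $R$ by contraction: on monomials $y^a\circ x^b=x^{b-a}$ if $a\le b$ componentwise and $y^a\circ x^b=0$ otherwise, extended bilinearly. For a form $F\in R$ let $\mathrm{Ann}(F)=\{\Phi\in S:\Phi\circ F=0\}$. View $S$ as the homogeneous coordinate ring of the projective space $\mathbf P(R_1)=\operatorname{Proj} S$, and define the cactus rank of $F$ by $$cr(F)=\min\{\deg\Gamma \;:\; \Gamma\subset\mathbf P(R_1)\text{ a closed subscheme},\ \dim\Gamma=0,\ I_\Gamma\subset\mathrm{Ann}(F)\},$$ where $I_\Gamma\subset S$ is the homogeneous ideal generated by the forms vanishing on $\Gamma$ and $\deg\Gamma=\dim_{\mathsf k}\Gamma(\Gamma,\mathcal O_\Gamma)$. Let $X=(x_{ij})$ be the generic skew-symmetric $2n\times 2n$ matrix ($x_{ji}=-x_{ij}$, $x_{ii}=0$) and $$\mathrm{Pf}(X)=\sum_{\sigma\in F_{2n}}\operatorname{sgn}(\sigma)\,x_{\sigma(1)\sigma(2)}x_{\sigma(3)\sigma(4)}\cdots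 x_{\sigma(2n-1)\sigma(2n)},$$ where $F_{2n}$ is the set of permutations $\sigma$ of $\{1,\dots,2n\}$ with $\sigma(1)<\sigma(3)<\dots<\sigma(2n-1)$ and $\sigma(2i-1)<\sigma(2i)$ for $1\le i\le n$. Then the apolar length is $\dim_{\mathsf k} S/\mathrm{Ann}(\mathrm{Pf}(X))=2^{2n-1}$, and $$2^{2n-2}\;\le\; cr(\mathrm{Pf}(X))\;\le\; 2^{2n-1}.$$ -/

import Mathlib

open AlgebraicGeometry CategoryTheory

universe u

section Apolarity

variable {σ : Type} {k : Type u} [Field k]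

/-- Contraction by the monomial `y ^ a`: the `k`-linear endomorphism of `k[x_i : i ∈ σ]` that sends
`x ^ b` to `x ^ (b - a)` if `a ≤ b` and to `0` otherwise. -/
noncomputable def contractMonomial (a : σ →₀ ℕ) : Module.End k (MvPolynomial σ k) where
  toFun F := F.divMonomial a
  map_add' F G := MvPolynomial.add_divMonomial F G a
  map_smul' c F := by ext; simp

/-- The contraction action of `S = k[y_i : i ∈ σ]` on `R = k[x_i : i ∈ σ]`: `contract Φ F` is
`Φ ∘ F`, the bilinear extension of the contraction by monomials. -/
noncomputable def contract : MvPolynomial σ k →ₐ[k] Module.End k (MvPolynomial σ k) :=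
  AddMonoidAlgebra.lift k (Module.End k (MvPolynomial σ k)) (σ →₀ ℕ)
    { toFun := fun a => contractMonomial a.toAdd
      map_one' := LinearMap.ext fun F => MvPolynomial.divMonomial_zero F
      map_mul' := fun a b => LinearMap.ext fun F => by
        change F.divMonomial (a.toAdd + b.toAdd) = (F.divMonomial b.toAdd).divMonomial a.toAdd
        rw [add_comm, MvPolynomial.divMonomial_add] }

/-- The apolar ideal `Ann(F) ⊆ S` of `F ∈ R`: all `Φ` with `Φ ∘ F = 0`. -/
noncomputable def apolarIdeal (F : MvPolynomial σ k) : Ideal (MvPolynomial σ k) where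
  carrier := {Φ | contract Φ F = 0}
  add_mem' {Φ Ψ} hΦ hΨ := by
    simp only [Set.mem_ofPred_eq] at hΦ hΨ ⊢
    rw [map_add, LinearMap.add_apply, hΦ, hΨ, add_zero]
  zero_mem' := by
    simp only [Set.mem_ofPred_eq]
    rw [map_zero, LinearMap.zero_apply]
  smul_mem' Ψ Φ hΦ := by
    simp only [Set.mem_ofPred_eq] at hΦ ⊢
    rw [smul_eq_mul, map_mul, Module.End.mul_apply, hΦ, map_zero]

end Apolarity

section CactusRank

attribute [local instance] MvPolynomial.gradedAlgebra

variable (σ : Type) (k : Type u) [Field k]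

/-- The projective space `P(R_1)` of lines in the space `R_1` of linear forms: it is `Proj S`,
where `S = k[y_i : i ∈ σ]` has the standard grading. -/
noncomputable abbrev apolarSpace : Scheme.{u} :=
  Proj (MvPolynomial.homogeneousSubmodule σ k)

/-- The structure morphism of `P(R_1)` over `k`. -/
noncomputable def apolarSpaceStructure : apolarSpace σ k ⟶ Spec (CommRingCat.of k) :=
  Proj.toSpecZero (MvPolynomial.homogeneousSubmodule σ k) ≫
    Spec.map (CommRingCat.ofHom (algebraMap k (MvPolynomial.homogeneousSubmodule σ k 0)))

variable {σ k}

/-- The degree `dim_k Γ(Z, 𝒪_Z)` of a zero-dimensional scheme `Z` of finite type over `k`. -/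
noncomputable def schemeDegree {Z : Scheme.{u}} (f : Z ⟶ Spec (CommRingCat.of k)) : ℕ :=
  letI := ((Scheme.ΓSpecIso (CommRingCat.of k)).inv ≫ f.appTop).hom.toAlgebra
  Module.finrank k Γ(Z, ⊤)

/-- The regular function `Φ / y_j ^ t` on the chart `D₊(y_j)` of `P(R_1)`, for a form `Φ` of
degree `t`. -/
noncomputable def formOnChart (j : σ) {t : ℕ} (Φ : MvPolynomial σ k) (hΦ : Φ.IsHomogeneous t) :
    Γ(apolarSpace σ k, Proj.basicOpen (MvPolynomial.homogeneousSubmodule σ k)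
      (MvPolynomial.X j)) :=
  (Proj.awayToSection (MvPolynomial.homogeneousSubmodule σ k) (MvPolynomial.X j)).hom
    (HomogeneousLocalization.Away.mk (MvPolynomial.homogeneousSubmodule σ k)
      (MvPolynomial.isHomogeneous_X k j) t Φ
      (by rw [smul_eq_mul, mul_one]; exact hΦ))

/-- The homogeneous ideal `I_Z ⊆ S` of a closed subscheme `i : Z ⟶ P(R_1)`: it is generated by the
forms that vanish identically on `Z`, that is, whose dehomogenization on each standard chart
restricts to zero on `Z`. -/
noncomputable def vanishingHomogeneousIdeal {Z : Scheme.{u}} (i : Z ⟶ apolarSpace σ k) :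
    Ideal (MvPolynomial σ k) :=
  Ideal.span {Φ | ∃ (t : ℕ) (hΦ : Φ.IsHomogeneous t),
    ∀ j : σ, (i.app _).hom (formOnChart j Φ hΦ) = 0}

/-- The degrees of the zero-dimensional closed subschemes `Z ⊆ P(R_1)` that are apolar to `F`,
that is, for which `I_Z ⊆ Ann(F)`. -/
def apolarDegrees (F : MvPolynomial σ k) : Set ℕ :=
  {d | ∃ (Z : Scheme.{u}) (i : Z ⟶ apolarSpace σ k),
    IsClosedImmersion i ∧ topologicalKrullDim Z = 0 ∧
    vanishingHomogeneousIdeal i ≤ apolarIdeal F ∧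
    schemeDegree (i ≫ apolarSpaceStructure σ k) = d}

/-- The cactus rank of `F`: the least degree of a zero-dimensional closed subscheme of `P(R_1)`
apolar to `F` (`⊤` if there is none). -/
noncomputable def cactusRank (F : MvPolynomial σ k) : ℕ∞ :=
  ⨅ d ∈ apolarDegrees F, (d : ℕ∞)

end CactusRank

section Pfaffian

/-- The set `F_{2n}` of permutations `π` of the `2n` indices, here numbered from `0`, with
`π 0 < π 2 < ⋯ < π (2n - 2)` and `π (2i) < π (2i + 1)` for all `i < n`. -/
def pfaffianPerms (n : ℕ) : Set (Equiv.Perm (Fin (2 * n))) :=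
  {π | (∀ i j : Fin n, i < j → π ⟨2 * i, by omega⟩ < π ⟨2 * j, by omega⟩) ∧
    ∀ i : Fin n, π ⟨2 * i, by omega⟩ < π ⟨2 * i + 1, by omega⟩}

open scoped Classical in
/-- The Pfaffian of a (skew-symmetric) `2n × 2n` matrix. -/
noncomputable def pfaffian {A : Type*} [CommRing A] {n : ℕ}
    (M : Matrix (Fin (2 * n)) (Fin (2 * n)) A) : A :=
  ∑ π : Equiv.Perm (Fin (2 * n)) with π ∈ pfaffianPerms n,
    ((Equiv.Perm.sign π : ℤ) : A) *
      ∏ i : Fin n, M (π ⟨2 * i, by omega⟩) (π ⟨2 * i + 1, by omega⟩)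

/-- The index set of the variables `x_{ij}`, `i < j`, of an `m × m` skew-symmetric matrix. -/
abbrev SkewVar (m : ℕ) : Type := {p : Fin m × Fin m // p.1 < p.2}

/-- The generic `m × m` skew-symmetric matrix over `k`. -/
noncomputable def genericSkew (k : Type u) [Field k] (m : ℕ) :
    Matrix (Fin m) (Fin m) (MvPolynomial (SkewVar m) k) := fun i j =>
  if h : i < j then MvPolynomial.X ⟨(i, j), h⟩
  else if h : j < i then -MvPolynomial.X ⟨(j, i), h⟩
  else 0

end Pfaffian

/-! ### Multiplication by elements generating the unit ideal -/

section MultiplicationRank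

/-! Write `S` for the ring of the `y_ij` and `θ : S → ⋀ k^{2n}` for the map `y_ij ↦ e_i ∧ e_j`,
which is well defined because products of two vectors are central. The coefficient of `x^m` in the
Pfaffian is the top coefficient of `θ(y^m)` (`coeff_pfaffian`). So `Φ ∘ Pf` records the pairings of
`θ(Φ)` with the image of `θ`, which is the even part of the exterior algebra. That pairing is
perfect, so the apolar length is the number of even subsets of a `2n`-set, `2^{2n-1}`.

Lower bound: let `Z` be finite and apolar to `F`, and `B = Γ(Z, 𝒪_Z)`. Trivializing `𝒪(1)` on `Z`
gives `ψ : S → B` with the `ψ(y_i)` generating the unit ideal. Put `W_t = ψ(S_t)` and `a_t = dim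
(S_t ∘ F)`. Forms killed by `ψ` are apolar, so `a_t = dim W_t - dim ψ(Ann(F)_t)`. If all `y_i²` lie
in `Ann(F)`, then `y_i² S_t ⊆ Ann(F)_{t+2}`, and since the `ψ(y_i)²` generate the unit ideal, `dim
ψ(Ann(F)_{t+2}) ≥ dim W_t` (`Submodule.finrank_le_of_smul_mem`). Hence `a_{t+2} ≤ dim W_{t+2} - dim
W_t`; telescoping over even and odd `t` gives `∑ a_t ≤ 2 dim B`. For the Pfaffian, `y_ij²` is apolar
because `(e_i ∧ e_j)² = 0`.

Upper bound: let `f` be `F` with `x_j = 1`. Then `S / Ann(f)` is a finite quotient of the coordinate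
ring of the chart `y_j ≠ 0`, its spectrum is apolar to `F`, and `S ∘ f` lies in the dehomogenization
of `S ∘ F`, so its degree is at most the apolar length (`cactusRank_le_finrank`). -/

theorem Submodule.finrank_map_add_finrank_inf_ker {k M N : Type*} [Field k] [AddCommGroup M]
    [Module k M] [AddCommGroup N] [Module k N] [FiniteDimensional k M] (f : M →ₗ[k] N)
    (W : Submodule k M) :
    Module.finrank k (W.map f) + Module.finrank k (W ⊓ LinearMap.ker f : Submodule k M) =
      Module.finrank k W := by
  have h := LinearMap.finrank_range_add_finrank_ker (f.domRestrict W)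
  rw [LinearMap.range_domRestrict, LinearMap.ker_domRestrict] at h
  rw [← h, ← Submodule.map_comap_subtype,
    LinearEquiv.finrank_eq (Submodule.equivMapOfInjective W.subtype W.injective_subtype _).symm]

/-- If the elements `b i` generate the unit ideal, multiplying a subspace `W` of a
finite-dimensional module by all the `b i` does not decrease its dimension. -/
theorem Submodule.finrank_le_of_smul_mem {k B ι : Type*} [Field k] [CommRing B] [Algebra k B]
    (b : ι → B) (hb : Ideal.span (Set.range b) = ⊤) (d : ℕ) :
    ∀ (M : Type u) [AddCommGroup M] [Module k M] [Module B M] [IsScalarTower k B M]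
      [FiniteDimensional k M] (W U : Submodule k M), Module.finrank k M = d →
      (∀ i, ∀ w ∈ W, b i • w ∈ U) → Module.finrank k W ≤ Module.finrank k U := by
  induction d using Nat.strong_induction_on with
  | _ d ih =>
    intro M _ _ _ _ _ W U hd hWU
    by_cases hN : ∃ N : Submodule B M, N ≠ ⊥ ∧ N ≠ ⊤
    -- Dimensions of `W` and `U` add along `0 → N → M → M ⧸ N`, and the hypothesis passes to both
    -- ends, so induction applies to each.
    · obtain ⟨N, hbot, htop⟩ := hN
      let f : M →ₗ[k] M ⧸ N := N.mkQ.restrictScalars k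
      have hker : LinearMap.ker f = N.restrictScalars k := by
        ext x; simp [f]
      have hadd : Module.finrank k (M ⧸ N) + Module.finrank k N = Module.finrank k M := by
        have := LinearMap.finrank_range_add_finrank_ker f
        rwa [LinearMap.range_eq_top.mpr (show Function.Surjective f from N.mkQ_surjective),
          finrank_top, hker] at this
      have : FiniteDimensional k N :=
        inferInstanceAs (FiniteDimensional k (N.restrictScalars k))
      have hNpos : 0 < Module.finrank k N := by
        have : Nontrivial N := Submodule.nontrivial_iff_ne_bot.mpr hbot
        exact Module.finrank_pos
      have hQpos : 0 < Module.finrank k (M ⧸ N) := by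
        have : Nontrivial (M ⧸ N) := Submodule.Quotient.nontrivial_iff.mpr htop
        exact Module.finrank_pos
      let g : N →ₗ[k] M := N.subtype.restrictScalars k
      have hg : Function.Injective g := N.injective_subtype
      have hrange : LinearMap.range g = LinearMap.ker f := by
        rw [hker]; ext x; simp [g]
      have hinf (V : Submodule k M) : Module.finrank k (V ⊓ LinearMap.ker f : Submodule k M) =
          Module.finrank k (V.comap g) := by
        rw [(Submodule.equivMapOfInjective g hg (V.comap g)).finrank_eq, Submodule.map_comap_eq,
          hrange, inf_comm]
      rw [← Submodule.finrank_map_add_finrank_inf_ker f W,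
        ← Submodule.finrank_map_add_finrank_inf_ker f U, hinf, hinf]
      refine add_le_add (ih _ (by omega) (M ⧸ N) (W.map f) (U.map f) rfl ?_)
        (ih _ (by omega) N (W.comap g) (U.comap g) rfl ?_)
      · rintro i _ ⟨w, hw, rfl⟩
        exact ⟨b i • w, hWU i w hw, rfl⟩
      · exact fun i w hw => hWU i _ hw
    -- Now `M` is simple or zero, so each `b i` acts injectively or as zero. If all act as zero, so
    -- does `1`, and `M = 0`.
    · push Not at hN
      by_cases h : ∃ i, LinearMap.ker (LinearMap.lsmul B M (b i)) = ⊥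
      · obtain ⟨i, hi⟩ := h
        let f : M →ₗ[k] M := (LinearMap.lsmul B M (b i)).restrictScalars k
        have hf : Function.Injective f := (LinearMap.ker_eq_bot (f := LinearMap.lsmul B M (b i))).mp hi
        rw [(Submodule.equivMapOfInjective f hf W).finrank_eq]
        refine Submodule.finrank_mono ?_
        rintro _ ⟨w, hw, rfl⟩
        exact hWU i w hw
      · push Not at h
        have hann : (1 : B) ∈ Module.annihilator B M := by
          have : Ideal.span (Set.range b) ≤ Module.annihilator B M := by
            rw [Ideal.span_le]
            rintro _ ⟨i, rfl⟩
            rw [SetLike.mem_coe, Module.mem_annihilator]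
            intro m
            have : m ∈ LinearMap.ker (LinearMap.lsmul B M (b i)) := by
              rw [hN _ (h i)]; trivial
            simpa using this
          exact this (hb ▸ Submodule.mem_top)
        have : W = ⊥ := by
          rw [eq_bot_iff]
          intro w _
          simpa using Module.mem_annihilator.mp hann w
        rw [this, finrank_bot]; exact Nat.zero_le _

end MultiplicationRank

/-! ### Contraction and the numerical lower bound -/

section Contraction

open MvPolynomial

variable {σ : Type} {k : Type u} [Field k]

theorem contract_monomial (a : σ →₀ ℕ) (c : k) (F : MvPolynomial σ k) :
    contract (monomial a c) F = c • F.divMonomial a := by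
  have : contract (monomial a c : MvPolynomial σ k) = c • contractMonomial a :=
    AddMonoidAlgebra.lift_single _ _ _
  rw [this]; rfl

theorem coeff_contract_monomial (a b : σ →₀ ℕ) (c : k) (F : MvPolynomial σ k) :
    coeff b (contract (monomial a c) F) = c * coeff (a + b) F := by
  rw [contract_monomial, coeff_smul, coeff_divMonomial, smul_eq_mul]

theorem mem_apolarIdeal {F Φ : MvPolynomial σ k} : Φ ∈ apolarIdeal F ↔ contract Φ F = 0 := Iff.rfl

/-- The `k`-linear map `Φ ↦ Φ ∘ F`. -/
noncomputable def contractOn (F : MvPolynomial σ k) : MvPolynomial σ k →ₗ[k] MvPolynomial σ k :=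
  LinearMap.applyₗ F ∘ₗ contract.toLinearMap

theorem contractOn_apply (F Φ : MvPolynomial σ k) : contractOn F Φ = contract Φ F := rfl

theorem ker_contractOn (F : MvPolynomial σ k) :
    LinearMap.ker (contractOn F) = (apolarIdeal F).restrictScalars k := by
  ext; rfl

/-- `S / Ann(F)` is isomorphic to the space of all contractions of `F`. -/
noncomputable def quotientApolarEquiv (F : MvPolynomial σ k) :
    (MvPolynomial σ k ⧸ apolarIdeal F) ≃ₗ[k] LinearMap.range (contractOn F) :=
  (Submodule.Quotient.restrictScalarsEquiv k (apolarIdeal F)).symm ≪≫ₗ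
    Submodule.quotEquivOfEq _ _ (ker_contractOn F).symm ≪≫ₗ (contractOn F).quotKerEquivRange

theorem contract_eq_zero_of_totalDegree_lt {F Φ : MvPolynomial σ k} {t : ℕ}
    (hΦ : Φ.IsHomogeneous t) (ht : F.totalDegree < t) : contract Φ F = 0 := by
  rw [Φ.as_sum, map_sum, LinearMap.sum_apply]
  refine Finset.sum_eq_zero fun a ha => ?_
  ext b
  rw [coeff_contract_monomial, coeff_zero, coeff_eq_zero_of_totalDegree_lt (f := F), mul_zero]
  have h1 : a.degree = t := by
    rw [Finsupp.degree_eq_weight_one]; exact hΦ (mem_support_iff.mp ha)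
  have h2 : (a + b).degree = a.degree + b.degree := map_add Finsupp.degree a b
  change F.totalDegree < (a + b).degree
  omega

theorem range_contractOn_le (F : MvPolynomial σ k) :
    LinearMap.range (contractOn F) ≤
      ⨆ t ∈ Finset.range (F.totalDegree + 1), (homogeneousSubmodule σ k t).map (contractOn F) := by
  rintro _ ⟨Φ, rfl⟩
  rw [← sum_homogeneousComponent Φ, map_sum]
  refine sum_mem fun t _ => ?_
  by_cases ht : F.totalDegree < t
  · rw [contractOn_apply,
      contract_eq_zero_of_totalDegree_lt (homogeneousComponent_isHomogeneous t Φ) ht]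
    exact zero_mem _
  · exact Submodule.mem_iSup_of_mem t (Submodule.mem_iSup_of_mem
      (Finset.mem_range.mpr (by omega)) ⟨_, homogeneousComponent_isHomogeneous t Φ, rfl⟩)

theorem Submodule.finrank_biSup_le {V : Type*} [AddCommGroup V] [Module k V]
    (W : ℕ → Submodule k V) (hW : ∀ t, FiniteDimensional k (W t)) (s : Finset ℕ) :
    FiniteDimensional k (⨆ t ∈ s, W t : Submodule k V) ∧
      Module.finrank k (⨆ t ∈ s, W t : Submodule k V) ≤ ∑ t ∈ s, Module.finrank k (W t) := by
  classical
  induction s using Finset.induction_on with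
  | empty =>
    have h : (⨆ t ∈ (∅ : Finset ℕ), W t) = ⊥ := by simp
    rw [h]
    exact ⟨inferInstance, by simp⟩
  | insert a s ha ih =>
    rw [Finset.iSup_insert, Finset.sum_insert ha]
    have := ih.1
    exact ⟨inferInstance, (Submodule.finrank_add_le_finrank_add_finrank _ _).trans
      (by gcongr; exact ih.2)⟩

/-- A finite algebra `B` of dimension `d` with elements `b i` generating the unit ideal bounds the
apolar length of `F` by `2 d`, if the forms vanishing at `b` are apolar to `F` and `F` is killed by
the squares of the variables. -/
theorem finrank_quotient_apolarIdeal_le [Finite σ] {F : MvPolynomial σ k}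
    (hF : ∀ i, (X i ^ 2 : MvPolynomial σ k) ∈ apolarIdeal F) {B : Type u} [CommRing B] [Algebra k B]
    [FiniteDimensional k B] (ψ : MvPolynomial σ k →ₐ[k] B)
    (hψ : Ideal.span (Set.range fun i => ψ (X i)) = ⊤)
    (h : ∀ (t : ℕ) (Φ : MvPolynomial σ k), Φ.IsHomogeneous t → ψ Φ = 0 → Φ ∈ apolarIdeal F) :
    Module.finrank k (MvPolynomial σ k ⧸ apolarIdeal F) ≤ 2 * Module.finrank k B := by
  let H (t : ℕ) : Submodule k (MvPolynomial σ k) := homogeneousSubmodule σ k t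
  have hH (t : ℕ) : FiniteDimensional k (H t) :=
    Module.Finite.iff_fg.mpr (homogeneousSubmodule_fg σ k t)
  let W (t : ℕ) : Submodule k B := (H t).map ψ.toLinearMap
  let α (t : ℕ) : H t →ₗ[k] MvPolynomial σ k := (contractOn F).domRestrict (H t)
  let β (t : ℕ) : H t →ₗ[k] B := ψ.toLinearMap.domRestrict (H t)
  have hβ (t : ℕ) : Module.finrank k (W t) = Module.finrank k (LinearMap.range (β t)) := by
    rw [LinearMap.range_domRestrict]
  have hsq : Ideal.span (Set.range fun i => ψ (X i) ^ 2) = ⊤ := by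
    have := Ideal.span_pow_eq_top _ hψ 2
    rwa [← Set.range_comp] at this
  have hle (t : ℕ) : LinearMap.ker (β t) ≤ LinearMap.ker (α t) :=
    fun Φ hΦ => LinearMap.mem_ker.mpr
      (mem_apolarIdeal.mp (h t Φ.1 Φ.2 (LinearMap.mem_ker.mp hΦ)))
  -- Rank-nullity for `α t`, for `β t`, and for `β t` on `ker (α t)`, which contains `ker (β t)`.
  have hrank (t : ℕ) : Module.finrank k (LinearMap.range (α t)) +
      Module.finrank k ((LinearMap.ker (α t)).map (β t)) = Module.finrank k (W t) := by
    have h1 := LinearMap.finrank_range_add_finrank_ker (α t)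
    have h2 := LinearMap.finrank_range_add_finrank_ker (β t)
    have h3 := Submodule.finrank_map_add_finrank_inf_ker (β t) (LinearMap.ker (α t))
    rw [inf_eq_right.mpr (hle t)] at h3
    rw [hβ]
    omega
  -- Multiplying by `X i ^ 2` sends forms of degree `t` into the apolar forms of degree `t + 2`, so
  -- `W t` is no larger than the image of the latter.
  have hstep (t : ℕ) : Module.finrank k (LinearMap.range (α (t + 2))) + Module.finrank k (W t) ≤
      Module.finrank k (W (t + 2)) := by
    rw [← hrank (t + 2)]
    refine Nat.add_le_add_left (Submodule.finrank_le_of_smul_mem _ hsq _ B _ _ rfl ?_) _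
    rintro i _ ⟨Φ, hΦ, rfl⟩
    refine ⟨⟨X i ^ 2 * Φ, ?_⟩, LinearMap.mem_ker.mpr ?_, ?_⟩
    · have := ((isHomogeneous_X k i).pow 2).mul hΦ
      rwa [one_mul, add_comm] at this
    · exact mem_apolarIdeal.mp ((apolarIdeal F).mul_mem_right Φ (hF i))
    · exact (map_mul ψ _ _).trans (by rw [map_pow]; rfl)
  -- `hstep` moves by two degrees, so the sum telescopes along each parity class, leaving two terms
  -- `W N` and `W (N + 1)`; this is the source of the factor 2.
  have hsum (N : ℕ) : ∑ t ∈ Finset.range (N + 2), Module.finrank k (LinearMap.range (α t)) ≤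
      Module.finrank k (W N) + Module.finrank k (W (N + 1)) := by
    induction N with
    | zero =>
      have h0 := hrank 0
      have h1 := hrank 1
      rw [Finset.sum_range_succ, Finset.sum_range_succ, Finset.sum_range_zero]
      change _ ≤ Module.finrank k (W 0) + Module.finrank k (W 1)
      omega
    | succ N ih =>
      rw [Finset.sum_range_succ]
      have := hstep N
      change _ ≤ Module.finrank k (W (N + 1)) + Module.finrank k (W (N + 2))
      omega
  have hα (t : ℕ) : LinearMap.range (α t) = (H t).map (contractOn F) :=
    LinearMap.range_domRestrict _ _
  have hbi := Submodule.finrank_biSup_le (fun t => (H t).map (contractOn F))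
    (fun t => inferInstance) (Finset.range (F.totalDegree + 1))
  have := hbi.1
  calc Module.finrank k (MvPolynomial σ k ⧸ apolarIdeal F)
      = Module.finrank k (LinearMap.range (contractOn F)) := (quotientApolarEquiv F).finrank_eq
    _ ≤ _ := Submodule.finrank_mono (range_contractOn_le F)
    _ ≤ ∑ t ∈ Finset.range (F.totalDegree + 1), Module.finrank k (LinearMap.range (α t)) := by
      exact hbi.2.trans_eq (Finset.sum_congr rfl fun t _ => by rw [hα])
    _ ≤ ∑ t ∈ Finset.range (F.totalDegree + 2), Module.finrank k (LinearMap.range (α t)) :=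
      Finset.sum_le_sum_of_subset (Finset.range_mono (by omega))
    _ ≤ _ := hsum _
    _ ≤ 2 * Module.finrank k B := by
      rw [two_mul]
      exact add_le_add (Submodule.finrank_le _) (Submodule.finrank_le _)

end Contraction

/-! ### Forms as functions on the standard charts -/

section Charts

open MvPolynomial

theorem MvPolynomial.IsHomogeneous.eval₂_mul_eq {σ A L : Type*} [CommSemiring A] [CommSemiring L]
    {Φ : MvPolynomial σ A} {t : ℕ} (hΦ : Φ.IsHomogeneous t) (φ : MvPolynomial σ A →+* L) (v : L) :
    MvPolynomial.eval₂ (φ.comp C) (fun i => v * φ (X i)) Φ = v ^ t * φ Φ := by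
  conv_rhs => rw [Φ.as_sum, map_sum, Finset.mul_sum]
  rw [MvPolynomial.eval₂_eq]
  refine Finset.sum_congr rfl fun d hd => ?_
  have hdeg : ∑ i ∈ d.support, d i = t := by
    rw [← hΦ (mem_support_iff.mp hd), show (1 : σ → ℕ) = fun _ => 1 from rfl,
      ← Finsupp.degree_eq_weight_one]
    rfl
  rw [Finset.prod_congr rfl fun i _ => mul_pow v (φ (X i)) (d i), Finset.prod_mul_distrib,
    Finset.prod_pow_eq_pow_sum, hdeg, monomial_eq, map_mul, Finsupp.prod, map_prod]
  simp only [map_pow, RingHom.comp_apply]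
  ring

attribute [local instance] MvPolynomial.gradedAlgebra

variable {σ : Type} {k : Type u} [Field k]

/-- The fraction `Φ / y_j ^ t` for a form `Φ` of degree `t`. -/
noncomputable def formFraction (j : σ) {t : ℕ} (Φ : MvPolynomial σ k) (hΦ : Φ.IsHomogeneous t) :
    HomogeneousLocalization.Away (homogeneousSubmodule σ k) (X j) :=
  HomogeneousLocalization.Away.mk (homogeneousSubmodule σ k) (isHomogeneous_X k j) t Φ
    (by rw [smul_eq_mul, mul_one]; exact hΦ)

/-- The constants in the coordinate ring of a standard chart. -/
noncomputable def chartConst (j : σ) :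
    k →+* HomogeneousLocalization.Away (homogeneousSubmodule σ k) (X j) :=
  (HomogeneousLocalization.fromZeroRingHom (homogeneousSubmodule σ k) _).comp
    (algebraMap k (homogeneousSubmodule σ k 0))

theorem val_formFraction (j : σ) {t : ℕ} (Φ : MvPolynomial σ k) (hΦ : Φ.IsHomogeneous t) :
    (formFraction j Φ hΦ).val = Localization.mk Φ (⟨X j ^ t, t, rfl⟩ : Submonoid.powers (X j : MvPolynomial σ k)) :=
  HomogeneousLocalization.Away.val_mk _ _ _ _ _

/-- Homogeneity gives `Φ(y / y_j) = Φ / y_j ^ t`, checked in the localization. Hence a ring map out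
of the chart is determined on forms by the values of the `y_i / y_j`. -/
theorem eval₂_formFraction (j : σ) {t : ℕ} (Φ : MvPolynomial σ k) (hΦ : Φ.IsHomogeneous t) :
    eval₂ (chartConst j) (fun i => formFraction j (X i) (isHomogeneous_X k i)) Φ =
      formFraction j Φ hΦ := by
  let L := Localization.Away (X j : MvPolynomial σ k)
  let v : L := Localization.mk 1 (⟨X j, Submonoid.mem_powers _⟩ :
    Submonoid.powers (X j : MvPolynomial σ k))
  refine HomogeneousLocalization.val_injective _ ?_
  change algebraMap (HomogeneousLocalization.Away (homogeneousSubmodule σ k) (X j)) L _ = _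
  rw [hom_eval₂]
  refine Eq.trans ?_ (val_formFraction j Φ hΦ).symm
  have h := hΦ.eval₂_mul_eq (algebraMap (MvPolynomial σ k) L) v
  have h1 : (algebraMap (MvPolynomial σ k) L).comp C =
      (algebraMap (HomogeneousLocalization.Away (homogeneousSubmodule σ k) (X j)) L).comp
        (chartConst j) := by
    ext c
    exact (Localization.mk_one_eq_algebraMap (M := Submonoid.powers (X j : MvPolynomial σ k))
      (C c)).symm
  have h2 : (fun i => v * algebraMap (MvPolynomial σ k) L (X i)) = fun i =>
      algebraMap (HomogeneousLocalization.Away (homogeneousSubmodule σ k) (X j)) L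
        (formFraction j (X i) (isHomogeneous_X k i)) := by
    ext i
    refine Eq.trans ?_ (val_formFraction j (X i) (isHomogeneous_X k i)).symm
    rw [← Localization.mk_one_eq_algebraMap,
      Localization.mk_mul, one_mul]
    congr 1
    ext; simp
  rw [← h1, ← h2, h, ← Localization.mk_one_eq_algebraMap, Localization.mk_pow, Localization.mk_mul,
    one_pow, one_mul]
  congr 1
  ext; simp

/-- The value of a section of the structure sheaf of `P(R_1)` at a point. -/
noncomputable def sectionValue {U : (apolarSpace σ k).Opens} (x : U) :
    Γ(apolarSpace σ k, U) →+*
      Localization.AtPrime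
        (show ProjectiveSpectrum (homogeneousSubmodule σ k) from x.1).asHomogeneousIdeal.toIdeal where
  toFun s := HomogeneousLocalization.val (s.1 x)
  map_one' := HomogeneousLocalization.val_one
  map_mul' s t := HomogeneousLocalization.val_mul (s.1 x) (t.1 x)
  map_zero' := HomogeneousLocalization.val_zero
  map_add' s t := HomogeneousLocalization.val_add (s.1 x) (t.1 x)

theorem eq_of_sectionValue_eq {U : (apolarSpace σ k).Opens} {s t : Γ(apolarSpace σ k, U)}
    (h : ∀ x : U, sectionValue x s = sectionValue x t) : s = t := by
  apply Subtype.ext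
  funext x
  exact HomogeneousLocalization.val_injective _ (h x)

theorem sectionValue_formOnChart {U : (apolarSpace σ k).Opens} {j : σ}
    (hj : U ≤ Proj.basicOpen (homogeneousSubmodule σ k) (X j)) {t : ℕ}
    (Φ : MvPolynomial σ k) (hΦ : Φ.IsHomogeneous t) (x : U) :
    sectionValue x ((apolarSpace σ k).presheaf.map (homOfLE hj).op (formOnChart j Φ hΦ)) =
      Localization.mk Φ
        (⟨X j, hj x.2⟩ ^ t : (show ProjectiveSpectrum (homogeneousSubmodule σ k) from
          x.1).asHomogeneousIdeal.toIdeal.primeCompl) := rfl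

/-- The change of trivialization `Φ / y_j ^ t = (Φ / y_l ^ t) (y_l / y_j) ^ t`; it transfers
vanishing from one chart to another. -/
theorem formOnChart_eq_mul_pow {j l : σ} {t : ℕ} (Φ : MvPolynomial σ k) (hΦ : Φ.IsHomogeneous t)
    {U : (apolarSpace σ k).Opens}
    (hj : U ≤ Proj.basicOpen (homogeneousSubmodule σ k) (X j))
    (hl : U ≤ Proj.basicOpen (homogeneousSubmodule σ k) (X l)) :
    (apolarSpace σ k).presheaf.map (homOfLE hj).op (formOnChart j Φ hΦ) =
      (apolarSpace σ k).presheaf.map (homOfLE hl).op (formOnChart l Φ hΦ) *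
      (apolarSpace σ k).presheaf.map (homOfLE hj).op
        (formOnChart j (X l) (isHomogeneous_X k l)) ^ t := by
  refine eq_of_sectionValue_eq fun x => ?_
  rw [map_mul, map_pow, sectionValue_formOnChart, sectionValue_formOnChart,
    sectionValue_formOnChart, Localization.mk_pow, Localization.mk_mul, Localization.mk_eq_mk_iff,
    Localization.r_iff_exists]
  refine ⟨1, ?_⟩
  simp only [Submonoid.coe_mul, SubmonoidClass.coe_pow, Submonoid.coe_one, pow_one]
  ring

end Charts

/-! ### The structure morphism of projective space -/

section Structure

open MvPolynomial

attribute [local instance] MvPolynomial.gradedAlgebra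

variable {σ : Type} {k : Type u} [Field k]

theorem algebraMap_homogeneousSubmodule_zero_surjective :
    Function.Surjective (algebraMap k (homogeneousSubmodule σ k 0)) := by
  rintro ⟨Φ, hΦ⟩
  refine ⟨coeff 0 Φ, Subtype.ext ?_⟩
  exact ((totalDegree_eq_zero_iff_eq_C).mp
    (Nat.le_zero.mp (IsHomogeneous.totalDegree_le hΦ))).symm

instance : IsClosedImmersion
    (Spec.map (CommRingCat.ofHom (algebraMap k (homogeneousSubmodule σ k 0)))) :=
  IsClosedImmersion.spec_of_surjective _ algebraMap_homogeneousSubmodule_zero_surjective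

instance : IsScalarTower k (homogeneousSubmodule σ k 0) (MvPolynomial σ k) :=
  ⟨fun _ _ _ => smul_mul_assoc _ _ _⟩

instance [Finite σ] : Algebra.FiniteType (homogeneousSubmodule σ k 0) (MvPolynomial σ k) :=
  Algebra.FiniteType.of_restrictScalars_finiteType k _ _

instance [Finite σ] : LocallyOfFiniteType (apolarSpaceStructure σ k) := by
  unfold apolarSpaceStructure; infer_instance

instance [Finite σ] : QuasiCompact (apolarSpaceStructure σ k) := by
  unfold apolarSpaceStructure; infer_instance

instance : IsSeparated (apolarSpaceStructure σ k) := by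
  unfold apolarSpaceStructure; infer_instance

theorem X_mem_homogeneousSubmodule (j : σ) :
    (X j : MvPolynomial σ k) ∈ homogeneousSubmodule σ k 1 := isHomogeneous_X k j

theorem awayι_apolarSpaceStructure (j : σ) :
    Proj.awayι (homogeneousSubmodule σ k) (X j) (X_mem_homogeneousSubmodule j) one_pos ≫
      apolarSpaceStructure σ k = Spec.map (CommRingCat.ofHom (chartConst j)) := by
  rw [apolarSpaceStructure, Proj.awayι_toSpecZero_assoc, ← Spec.map_comp]
  rfl

/-- Global sections of `awayι_apolarSpaceStructure`: it identifies the `k`-algebra structure coming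
from the structure morphism with the constants of each chart. -/
theorem apolarSpaceStructure_restrict (j : σ) (c : k) :
    (apolarSpace σ k).presheaf.map (homOfLE le_top).op
      ((apolarSpaceStructure σ k).appTop ((Scheme.ΓSpecIso (CommRingCat.of k)).inv c)) =
      Proj.awayToSection (homogeneousSubmodule σ k) (X j) (chartConst j c) := by
  let U := Proj.basicOpen (homogeneousSubmodule σ k) (X j)
  let φ := CommRingCat.ofHom (chartConst (k := k) j) ≫ Proj.awayToSection _ (X j)
  have h : U.ι ≫ apolarSpaceStructure σ k = U.toSpecΓ ≫ Spec.map φ := by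
    rw [Spec.map_comp, ← awayι_apolarSpaceStructure, ← Proj.basicOpenIsoSpec_inv_ι]
    simp only [Category.assoc]
    have := Proj.basicOpenIsoSpec_hom (homogeneousSubmodule σ k) (X j)
      (X_mem_homogeneousSubmodule j) one_pos
    rw [Proj.basicOpenToSpec] at this
    rw [← Category.assoc U.toSpecΓ, ← this, Iso.hom_inv_id_assoc]
  have h2 : (apolarSpaceStructure σ k).appTop ≫ U.ι.appTop =
      (Scheme.ΓSpecIso (CommRingCat.of k)).hom ≫ φ ≫ U.topIso.inv := by
    rw [← Scheme.Hom.comp_appTop, h, Scheme.Hom.comp_appTop, Scheme.Opens.toSpecΓ_appTop,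
      Scheme.ΓSpecIso_naturality_assoc]
  have h3 : U.ι.appTop ≫ U.topIso.hom =
      (apolarSpace σ k).presheaf.map (homOfLE le_top).op := by
    exact ((apolarSpace σ k).presheaf.map_comp _ _).symm
  have h4 : (Scheme.ΓSpecIso (CommRingCat.of k)).inv ≫ (apolarSpaceStructure σ k).appTop ≫
      (apolarSpace σ k).presheaf.map (homOfLE (le_top : U ≤ ⊤)).op = φ := by
    rw [← h3, reassoc_of% h2, Iso.inv_hom_id, Category.comp_id, Iso.inv_hom_id_assoc]
  exact congr($(h4).hom c)

end Structure

/-! ### From apolar schemes to finite algebras -/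

section SchemeLowerBound

open MvPolynomial TopologicalSpace

attribute [local instance] MvPolynomial.gradedAlgebra

variable {σ : Type} {k : Type u} [Field k]

theorem isLocallyArtinian_of_closedImmersion [Finite σ] {Z : Scheme.{u}} (i : Z ⟶ apolarSpace σ k)
    [IsClosedImmersion i] (hZ : topologicalKrullDim Z = 0) : IsLocallyArtinian Z := by
  have : IsLocallyNoetherian Z :=
    LocallyOfFiniteType.isLocallyNoetherian (i ≫ apolarSpaceStructure σ k)
  exact IsLocallyArtinian.of_topologicalKrullDim_le_zero hZ.le

/-- `Z` is locally Artinian, hence discrete, so its fibres over `Spec k` are discrete: the morphism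
is quasi-finite, which suffices for finiteness over a field. -/
theorem isFinite_of_closedImmersion [Finite σ] {Z : Scheme.{u}} (i : Z ⟶ apolarSpace σ k)
    [IsClosedImmersion i] (hZ : topologicalKrullDim Z = 0) :
    IsFinite (i ≫ apolarSpaceStructure σ k) := by
  have := isLocallyArtinian_of_closedImmersion i hZ
  have : LocallyQuasiFinite (i ≫ apolarSpaceStructure σ k) := by
    rw [locallyQuasiFinite_iff_isDiscrete_preimage_singleton]
    intro x
    exact ⟨inferInstance⟩
  exact IsFinite.of_locallyQuasiFinite _

theorem Scheme.Hom.map_app_apply {X Y : Scheme.{u}} (i : X ⟶ Y) {D W : Y.Opens} (hWD : W ≤ D)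
    {V : X.Opens} (hV : V ≤ i ⁻¹ᵁ W) (hV' : V ≤ i ⁻¹ᵁ D) (s : Γ(Y, D)) :
    X.presheaf.map (homOfLE hV').op (i.app D s) =
      X.presheaf.map (homOfLE hV).op (i.app W (Y.presheaf.map (homOfLE hWD).op s)) := by
  have h := i.naturality (homOfLE hWD).op
  have h2 : i.app D ≫ X.presheaf.map (homOfLE hV').op =
      Y.presheaf.map (homOfLE hWD).op ≫ i.app W ≫ X.presheaf.map (homOfLE hV).op := by
    rw [reassoc_of% h, ← Functor.map_comp]
    rfl
  exact congr($(h2).hom s)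

/-- Compatibility on overlaps is automatic: distinct pieces meet in `⊥`, where the ring of sections
is trivial. -/
theorem exists_glue_of_disjoint {Z : Scheme.{u}} {ι : Type} (U : ι → Z.Opens)
    (hU : ⊤ ≤ iSup U) (hd : ∀ l m, l ≠ m → U l ⊓ U m = ⊥) (s : ∀ l, Γ(Z, U l)) :
    ∃ a : Γ(Z, ⊤), ∀ l, Z.presheaf.map (homOfLE le_top).op a = s l := by
  obtain ⟨a, ha, -⟩ := Z.sheaf.existsUnique_gluing' U ⊤ (fun l => homOfLE le_top) hU s (by
    intro l m
    by_cases h : l = m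
    · subst h; rfl
    · have : Subsingleton Γ(Z, U l ⊓ U m) := by
        rw [hd l m h]
        infer_instance
      exact Subsingleton.elim (α := Γ(Z, U l ⊓ U m)) _ _)
  exact ⟨a, ha⟩

theorem eq_of_map_eq {Z : Scheme.{u}} {ι : Type} (U : ι → Z.Opens) {V : Z.Opens}
    (hUV : ∀ l, U l ≤ V) (hU : V ≤ iSup U) {s t : Γ(Z, V)}
    (h : ∀ l, Z.presheaf.map (homOfLE (hUV l)).op s = Z.presheaf.map (homOfLE (hUV l)).op t) :
    s = t :=
  Z.sheaf.eq_of_locally_eq' U V (fun l => homOfLE (hUV l)) hU s t h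

theorem formFraction_self (j : σ) : formFraction j (X j : MvPolynomial σ k)
    (isHomogeneous_X k j) = 1 := by
  refine HomogeneousLocalization.val_injective _ ?_
  rw [val_formFraction, HomogeneousLocalization.val_one]
  have h := Localization.mk_self
    (⟨X j ^ 1, 1, rfl⟩ : Submonoid.powers (X j : MvPolynomial σ k))
  rwa [show ((⟨X j ^ 1, 1, rfl⟩ : Submonoid.powers (X j : MvPolynomial σ k)) :
    MvPolynomial σ k) = X j from pow_one _] at h

/-- Choose for every point one chart containing its image; the fibres of this choice are open
because the topology is discrete. -/
theorem exists_partition_of_discreteTopology {Z : Scheme.{u}} [DiscreteTopology Z]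
    (i : Z ⟶ apolarSpace σ k) :
    ∃ U : σ → Z.Opens, ⊤ ≤ iSup U ∧ (∀ l m, l ≠ m → U l ⊓ U m = ⊥) ∧
      ∀ l, U l ≤ i ⁻¹ᵁ Proj.basicOpen (homogeneousSubmodule σ k) (X l) := by
  have hcover : ∀ z : Z, ∃ l, i z ∈ Proj.basicOpen (homogeneousSubmodule σ k) (X l) := by
    intro z
    have h := Proj.iSup_basicOpen_eq_top' (homogeneousSubmodule σ k) (X : σ → MvPolynomial σ k)
      (fun l => ⟨1, X_mem_homogeneousSubmodule l⟩) (by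
        rw [eq_top_iff]
        rintro Φ -
        induction Φ using MvPolynomial.induction_on with
        | C c => exact Subalgebra.algebraMap_mem _ (algebraMap k (homogeneousSubmodule σ k 0) c)
        | add p q hp hq => exact add_mem hp hq
        | mul_X p l hp => exact mul_mem hp (Algebra.subset_adjoin ⟨l, rfl⟩))
    exact Opens.mem_iSup.mp (h ▸ Opens.mem_top (i z))
  choose c hc using hcover
  refine ⟨fun l => ⟨{z | c z = l}, isOpen_discrete _⟩, ?_, ?_, ?_⟩
  · intro z _
    exact Opens.mem_iSup.mpr ⟨c z, rfl⟩
  · intro l m hlm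
    rw [eq_bot_iff]
    rintro z ⟨h1, h2⟩
    exact hlm (h1.symm.trans h2)
  · rintro l z rfl
    exact hc z

/-- On a discrete `Z` the sheaf `𝒪(1)` is trivial: dividing by `y_l` on the piece `U l` turns forms
into global functions, which supplies the map `ψ` of `finrank_quotient_apolarIdeal_le`. -/
theorem finrank_le_two_mul_of_mem_apolarDegrees [Finite σ] {F : MvPolynomial σ k}
    (hF : ∀ i, (X i ^ 2 : MvPolynomial σ k) ∈ apolarIdeal F) {d : ℕ} (hd : d ∈ apolarDegrees F) :
    Module.finrank k (MvPolynomial σ k ⧸ apolarIdeal F) ≤ 2 * d := by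
  obtain ⟨Z, i, hi, hZ, hann, rfl⟩ := hd
  have := Fintype.ofFinite σ
  classical
  have hart := isLocallyArtinian_of_closedImmersion i hZ
  have hfin := isFinite_of_closedImmersion i hZ
  obtain ⟨U, hcov, hdisj, hU⟩ := exists_partition_of_discreteTopology i
  let ρ : k →+* Γ(Z, ⊤) := ((Scheme.ΓSpecIso (CommRingCat.of k)).inv ≫
    (i ≫ apolarSpaceStructure σ k).appTop).hom
  let res (V : Z.Opens) : Γ(Z, ⊤) →+* Γ(Z, V) := (Z.presheaf.map (homOfLE le_top).op).hom
  let μ (l : σ) : HomogeneousLocalization.Away (homogeneousSubmodule σ k) (X l) →+* Γ(Z, U l) :=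
    (Proj.awayToSection (homogeneousSubmodule σ k) (X l) ≫ i.app _ ≫
      Z.presheaf.map (homOfLE (hU l)).op).hom
  have hext {s t : Γ(Z, ⊤)} (h : ∀ l, res (U l) s = res (U l) t) : s = t :=
    eq_of_map_eq U (fun _ => le_top) hcov h
  have hglue (s : ∀ l, Γ(Z, U l)) : ∃ a, ∀ l, res (U l) a = s l :=
    exists_glue_of_disjoint U hcov hdisj s
  have hρ (l : σ) : (res (U l)).comp ρ = (μ l).comp (chartConst l) := by
    ext c
    refine Eq.trans ?_ (congrArg (fun s => Z.presheaf.map (homOfLE (hU l)).op (i.app _ s))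
      (apolarSpaceStructure_restrict l c))
    exact Scheme.Hom.map_app_apply i le_top (hU l) le_top _
  -- `b m` is `y_m / y_l` on each `U l`, and `e m` below is the idempotent supported on `U m`. As `b
  -- m = 1` on `U m`, the combination `∑ e m * b m` equals 1.
  choose b hb using fun m => hglue fun l => μ l (formFraction l (X m) (isHomogeneous_X k m))
  choose e he using fun m => hglue fun l => if l = m then 1 else 0
  let := ρ.toAlgebra
  have hfd : FiniteDimensional k Γ(Z, ⊤) := by
    have : ρ.Finite := RingHom.Finite.comp (i ≫ apolarSpaceStructure σ k).finite_appTop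
      (RingHom.Finite.of_surjective _
        (Scheme.ΓSpecIso (CommRingCat.of k)).symm.commRingCatIsoToRingEquiv.surjective)
    exact this
  have haeval (l : σ) {t : ℕ} (Φ : MvPolynomial σ k) (hΦ : Φ.IsHomogeneous t) :
      res (U l) (aeval b Φ) = μ l (formFraction l Φ hΦ) := by
    rw [← eval₂_formFraction, hom_eval₂, ← hρ, aeval_def, hom_eval₂]
    simp only [hb]
    rfl
  refine finrank_quotient_apolarIdeal_le hF (aeval b) ?_ ?_
  · rw [Ideal.eq_top_iff_one]
    have h1 : ∑ m, e m * b m = 1 := by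
      refine hext fun l => ?_
      simp only [map_sum, map_mul, he, hb, ite_mul, one_mul, zero_mul, Finset.sum_ite_eq,
        Finset.mem_univ, if_true, formFraction_self, map_one]
    rw [← h1]
    refine sum_mem fun m _ => Ideal.mul_mem_left _ _ (Ideal.subset_span ⟨m, ?_⟩)
    simp
  · intro t Φ hΦ h0
    refine hann (Ideal.subset_span ⟨t, hΦ, fun j => ?_⟩)
    let D := Proj.basicOpen (homogeneousSubmodule σ k) (X j)
    -- On `U l ⊓ i ⁻¹ᵁ D` the function `Φ / y_j ^ t` is a multiple of `Φ / y_l ^ t`, the restriction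
    -- of `aeval b Φ = 0`.
    refine eq_of_map_eq (fun l => U l ⊓ i ⁻¹ᵁ D) (fun l => inf_le_right) ?_ fun l => ?_
    · intro z hz
      obtain ⟨l, hl⟩ := Opens.mem_iSup.mp (hcov (Opens.mem_top z))
      exact Opens.mem_iSup.mpr ⟨l, hl, hz⟩
    · let E := Proj.basicOpen (homogeneousSubmodule σ k) (X l)
      have hV : U l ⊓ i ⁻¹ᵁ D ≤ i ⁻¹ᵁ (D ⊓ E) := fun z hz => ⟨hz.2, hU l hz.1⟩
      rw [map_zero]
      refine (Scheme.Hom.map_app_apply i (inf_le_left : D ⊓ E ≤ D) hV inf_le_right _).trans ?_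
      rw [formOnChart_eq_mul_pow Φ hΦ inf_le_left inf_le_right, map_mul, map_mul]
      have h2 := haeval l Φ hΦ
      rw [h0, map_zero] at h2
      have h3 := Scheme.Hom.map_app_apply i (inf_le_right : D ⊓ E ≤ E) hV
        (inf_le_left.trans (hU l)) (formOnChart l Φ hΦ)
      rw [← h3]
      have h4 : Z.presheaf.map (homOfLE (inf_le_left.trans (hU l) : U l ⊓ i ⁻¹ᵁ D ≤ _)).op
          (i.app _ (formOnChart l Φ hΦ)) = Z.presheaf.map (homOfLE inf_le_left).op
            (μ l (formFraction l Φ hΦ)) :=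
        congr($(Z.presheaf.map_comp (homOfLE (hU l)).op
          (homOfLE (inf_le_left : U l ⊓ i ⁻¹ᵁ D ≤ _)).op).hom (i.app _ (formOnChart l Φ hΦ)))
      rw [h4, ← h2, map_zero, zero_mul]

end SchemeLowerBound

/-! ### Dehomogenization and contraction -/

section Dehomogenization

open MvPolynomial

attribute [local instance] MvPolynomial.gradedAlgebra

variable {σ : Type} {k : Type u} [Field k]

theorem coeff_contract (Φ F : MvPolynomial σ k) (m : σ →₀ ℕ) :
    coeff m (contract Φ F) = ∑ a ∈ Φ.support, coeff a Φ * coeff (a + m) F := by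
  conv_lhs => rw [Φ.as_sum, map_sum, LinearMap.sum_apply, coeff_sum]
  exact Finset.sum_congr rfl fun a _ => coeff_contract_monomial a m _ F

open scoped Classical in
/-- The dehomogenization `x_j = 1`. -/
noncomputable def dehomogenize (j : σ) : MvPolynomial σ k →ₐ[k] MvPolynomial σ k :=
  aeval fun i => if i = j then 1 else X i

theorem dehomogenize_monomial (j : σ) (a : σ →₀ ℕ) (c : k) :
    dehomogenize j (monomial a c) = monomial (a.erase j) c := by
  classical
  rw [dehomogenize, aeval_monomial, monomial_eq, algebraMap_eq]
  congr 1
  rw [← Finsupp.mul_prod_erase' a j _ (fun _ => pow_zero _), if_pos rfl, one_pow, one_mul]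
  refine Finsupp.prod_congr fun i hi => ?_
  rw [if_neg]
  rintro rfl
  simp at hi

/-- Among exponents of one fixed degree, the exponent of `j` is determined by the others, so no two
terms of a form merge. -/
theorem coeff_dehomogenize (j : σ) {F : MvPolynomial σ k} {n : ℕ} (hF : F.IsHomogeneous n)
    {b : σ →₀ ℕ} (hb : b.degree = n) : coeff (b.erase j) (dehomogenize j F) = coeff b F := by
  classical
  conv_lhs => rw [F.as_sum, map_sum, coeff_sum]
  simp only [dehomogenize_monomial, coeff_monomial]
  have h : ∀ a ∈ F.support, a.erase j = b.erase j ↔ a = b := by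
    refine fun a ha => ⟨fun h => ?_, fun h => by rw [h]⟩
    have ha : a.degree = n := by
      rw [Finsupp.degree_eq_weight_one]; exact hF (mem_support_iff.mp ha)
    have h1 := Finsupp.single_add_erase j a
    have h2 := Finsupp.single_add_erase j b
    have h3 := congrArg Finsupp.degree h1
    have h4 := congrArg Finsupp.degree h2
    rw [map_add, Finsupp.degree_single] at h3 h4
    have : a j = b j := by rw [h] at h3; omega
    rw [← h1, ← h2, h, this]
  rw [Finset.sum_congr rfl fun a ha => by rw [if_congr (h a ha) rfl rfl], Finset.sum_ite_eq']
  split_ifs with hb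
  · rfl
  · exact (notMem_support_iff.mp hb).symm

/-- In degree `n - t`, the coefficients of `Φ ∘ F` reappear among those of the contraction of the
dehomogenizations; in all other degrees they vanish. -/
theorem contract_eq_zero_of_dehomogenize (j : σ) {F Φ : MvPolynomial σ k} {n t : ℕ}
    (hF : F.IsHomogeneous n) (hΦ : Φ.IsHomogeneous t)
    (h : contract (dehomogenize j Φ) (dehomogenize j F) = 0) : contract Φ F = 0 := by
  have hdeg {a : σ →₀ ℕ} (ha : a ∈ Φ.support) : a.degree = t := by
    rw [Finsupp.degree_eq_weight_one]; exact hΦ (mem_support_iff.mp ha)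
  ext m
  rw [coeff_contract, coeff_zero]
  by_cases hm : t + m.degree = n
  · have h1 := congrArg (coeff (m.erase j)) h
    rw [coeff_zero, Φ.as_sum, map_sum, map_sum, LinearMap.sum_apply, coeff_sum] at h1
    rw [← h1]
    refine Finset.sum_congr rfl fun a ha => ?_
    rw [dehomogenize_monomial, coeff_contract_monomial, ← Finsupp.erase_add,
      coeff_dehomogenize j hF (by rw [map_add, hdeg ha, hm])]
  · refine Finset.sum_eq_zero fun a ha => ?_
    rw [hF.coeff_eq_zero, mul_zero]
    rw [map_add, hdeg ha]
    exact hm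

/-- A dehomogenized operator does not involve `y_j`, so its contraction leaves powers of `x_j` alone
and commutes with setting `x_j = 1`. -/
theorem contract_dehomogenize (j : σ) (Φ F : MvPolynomial σ k) :
    contract (dehomogenize j Φ) (dehomogenize j F) =
      dehomogenize j (contract (dehomogenize j Φ) F) := by
  induction Φ using MvPolynomial.induction_on' with
  | add p q hp hq => simp only [map_add, LinearMap.add_apply, hp, hq]
  | monomial a c =>
    induction F using MvPolynomial.induction_on' with
    | add p q hp hq => simp only [map_add, hp, hq]
    | monomial b d =>
      classical
      have key (a b : σ →₀ ℕ) : (monomial b d).divMonomial a =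
          if a ≤ b then monomial (b - a) d else 0 := by
        ext m
        rw [coeff_divMonomial, coeff_monomial]
        split_ifs with h1 h2 h2
        · rw [h1, coeff_monomial, if_pos (by simp)]
        · exact absurd (h1 ▸ le_self_add) h2
        · rw [coeff_monomial, if_neg]
          rintro rfl
          exact h1 (add_tsub_cancel_of_le h2).symm
        · simp
      rw [dehomogenize_monomial, dehomogenize_monomial, contract_monomial, contract_monomial,
        map_smul, key, key]
      have hle : a.erase j ≤ b.erase j ↔ a.erase j ≤ b := by
        constructor
        · intro h i
          rcases eq_or_ne i j with rfl | hij
          · simp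
          · have := h i
            rw [Finsupp.erase_ne hij, Finsupp.erase_ne hij] at this
            rwa [Finsupp.erase_ne hij]
        · intro h i
          rcases eq_or_ne i j with rfl | hij
          · simp
          · have := h i
            rw [Finsupp.erase_ne hij] at this
            rwa [Finsupp.erase_ne hij, Finsupp.erase_ne hij]
      split_ifs with h1 h2 h2
      · rw [dehomogenize_monomial]
        congr 1
        refine congrArg (fun e => monomial e d) (Finsupp.ext fun i => ?_)
        rcases eq_or_ne i j with rfl | hij
        · simp
        · simp [Finsupp.erase_ne hij]
      · exact absurd (hle.mp h1) h2
      · exact absurd (hle.mpr h2) h1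
      · simp

theorem X_mem_apolarIdeal_dehomogenize (j : σ) (F : MvPolynomial σ k) :
    (X j : MvPolynomial σ k) ∈ apolarIdeal (dehomogenize j F) := by
  rw [mem_apolarIdeal]
  induction F using MvPolynomial.induction_on' with
  | add p q hp hq => simp only [map_add, hp, hq, add_zero]
  | monomial b d =>
    classical
    ext m
    rw [dehomogenize_monomial, X, coeff_contract_monomial, coeff_monomial, if_neg, mul_zero,
      coeff_zero]
    intro h
    have := DFunLike.congr_fun h j
    simp at this
    omega

theorem formFraction_surjective (j : σ)
    (a : HomogeneousLocalization.Away (homogeneousSubmodule σ k) (X j)) :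
    ∃ (t : ℕ) (Φ : MvPolynomial σ k) (hΦ : Φ.IsHomogeneous t), formFraction j Φ hΦ = a := by
  obtain ⟨t, Φ, hΦ, rfl⟩ := HomogeneousLocalization.Away.mk_surjective _
    (X_mem_homogeneousSubmodule j) a
  have hΦ' : Φ.IsHomogeneous t := by rwa [smul_eq_mul, mul_one] at hΦ
  exact ⟨t, Φ, hΦ', rfl⟩

theorem isUnit_dehomogenize_X (j : σ) : IsUnit
    ((dehomogenize j : MvPolynomial σ k →ₐ[k] MvPolynomial σ k).toRingHom (X j)) := by
  simp [dehomogenize]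

/-- The map `Φ / y_j ^ t ↦ Φ|_{y_j = 1}` on the coordinate ring of a standard chart. -/
noncomputable def chartDehomogenize (j : σ) :
    HomogeneousLocalization.Away (homogeneousSubmodule σ k) (X j) →+* MvPolynomial σ k :=
  (IsLocalization.Away.lift (S := Localization.Away (X j : MvPolynomial σ k)) (X j)
    (isUnit_dehomogenize_X j)).comp
    (algebraMap (HomogeneousLocalization.Away (homogeneousSubmodule σ k) (X j)) _)

theorem chartDehomogenize_formFraction (j : σ) {t : ℕ} (Φ : MvPolynomial σ k)
    (hΦ : Φ.IsHomogeneous t) : chartDehomogenize j (formFraction j Φ hΦ) = dehomogenize j Φ := by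
  refine (congrArg (IsLocalization.Away.lift (S := Localization.Away (X j : MvPolynomial σ k)) _
    (isUnit_dehomogenize_X j)) (val_formFraction j Φ hΦ)).trans ?_
  rw [Localization.mk_eq_mk', IsLocalization.Away.lift, IsLocalization.lift_mk'_spec]
  simp [dehomogenize]

theorem chartDehomogenize_chartConst (j : σ) (c : k) :
    chartDehomogenize j (chartConst j c) = C c := by
  have h := eval₂_formFraction j (C c) (isHomogeneous_C σ c)
  rw [eval₂_C] at h
  rw [h, chartDehomogenize_formFraction]
  simp [dehomogenize]

end Dehomogenization

/-! ### An apolar scheme supported in one chart -/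

section SchemeUpperBound

open MvPolynomial TopologicalSpace

attribute [local instance] MvPolynomial.gradedAlgebra

variable {σ : Type} {k : Type u} [Field k]

/-- Pulling a function on the chart back to the spectrum of the chart ring returns the same ring
element. This turns vanishing on a subscheme into vanishing under a ring map. -/
theorem awayToSection_awayι_appLE (j : σ)
    (e : ⊤ ≤ Proj.awayι (homogeneousSubmodule σ k) (X j) (X_mem_homogeneousSubmodule j) one_pos
      ⁻¹ᵁ Proj.basicOpen (homogeneousSubmodule σ k) (X j)) :
    Proj.awayToSection (homogeneousSubmodule σ k) (X j) ≫
      (Proj.awayι (homogeneousSubmodule σ k) (X j) (X_mem_homogeneousSubmodule j) one_pos).appLE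
        (Proj.basicOpen (homogeneousSubmodule σ k) (X j)) ⊤ e =
      (Scheme.ΓSpecIso _).inv := by
  let U := Proj.basicOpen (homogeneousSubmodule σ k) (X j)
  let θ := Proj.basicOpenIsoSpec (homogeneousSubmodule σ k) (X j)
    (X_mem_homogeneousSubmodule j) one_pos
  have h1 : (Proj.awayι (homogeneousSubmodule σ k) (X j) (X_mem_homogeneousSubmodule j)
      one_pos).appLE U ⊤ e = U.topIso.inv ≫ θ.inv.appTop := by
    change (θ.inv ≫ U.ι).appLE U ⊤ e = _
    have h2 : U.ι.appLE U ⊤ (le_of_eq (Scheme.Opens.ι_preimage_self U).symm) = U.topIso.inv := by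
      rw [Scheme.Hom.appLE]
      exact ((apolarSpace σ k).presheaf.map_comp _ _).symm
    rw [← h2, ← Scheme.Hom.appLE_comp_appLE θ.inv U.ι U ⊤ ⊤
      (le_of_eq (Scheme.Opens.ι_preimage_self U).symm) le_top, Scheme.Hom.appTop,
      Scheme.Hom.app_eq_appLE]
    rfl
  have h3 : Proj.awayToSection (homogeneousSubmodule σ k) (X j) ≫ U.topIso.inv =
      (Scheme.ΓSpecIso _).inv ≫ θ.hom.appTop := by
    rw [Iso.eq_inv_comp, Proj.basicOpenIsoSpec_hom]
    exact (Proj.basicOpenToSpec_app_top _ _).symm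
  rw [h1, reassoc_of% h3, ← Scheme.Hom.comp_appTop, Iso.inv_hom_id, Scheme.Hom.id_appTop,
    Category.comp_id]

/-- A finite quotient `B` of the coordinate ring of a standard chart defines a zero-dimensional
closed subscheme of degree `dim B`, apolar to `F` if the forms vanishing in `B` are. -/
theorem finrank_mem_apolarDegrees (j : σ) {F : MvPolynomial σ k} {B : Type u} [CommRing B]
    [Algebra k B] [FiniteDimensional k B] [Nontrivial B]
    (q : HomogeneousLocalization.Away (homogeneousSubmodule σ k) (X j) →+* B)
    (hq : Function.Surjective q) (hqk : q.comp (chartConst j) = algebraMap k B)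
    (h : ∀ (t : ℕ) (Φ : MvPolynomial σ k) (hΦ : Φ.IsHomogeneous t),
      q (formFraction j Φ hΦ) = 0 → Φ ∈ apolarIdeal F) :
    Module.finrank k B ∈ apolarDegrees F := by
  let ι := Proj.awayι (homogeneousSubmodule σ k) (X j) (X_mem_homogeneousSubmodule j) one_pos
  let g := Spec.map (CommRingCat.ofHom q)
  have hg : IsClosedImmersion g := IsClosedImmersion.spec_of_surjective _ hq
  have hstr : (g ≫ ι) ≫ apolarSpaceStructure σ k =
      Spec.map (CommRingCat.ofHom (algebraMap k B)) := by
    rw [Category.assoc, awayι_apolarSpaceStructure, ← Spec.map_comp, ← CommRingCat.ofHom_comp, hqk]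
  refine ⟨Spec (CommRingCat.of B), g ≫ ι, ?_, ?_, ?_, ?_⟩
  -- The composite passes through an open chart, so closedness is not formal: `Spec B` is finite
  -- over `k`, hence over the separated projective space, and a finite monomorphism is a closed
  -- immersion.
  · have : IsFinite ((g ≫ ι) ≫ apolarSpaceStructure σ k) := by
      rw [hstr, IsFinite.SpecMap_iff]
      exact RingHom.finite_algebraMap.mpr inferInstance
    have : IsFinite (g ≫ ι) := IsFinite.of_comp _ (apolarSpaceStructure σ k)
    exact (IsClosedImmersion.iff_isFinite_and_mono _).mpr ⟨this, inferInstance⟩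
  · have : IsArtinianRing B := IsArtinianRing.of_finite k B
    exact (PrimeSpectrum.topologicalKrullDim_eq_ringKrullDim B).trans
      (ringKrullDimZero_iff_ringKrullDim_eq_zero.mp inferInstance)
  · refine Ideal.span_le.mpr ?_
    rintro Φ ⟨t, hΦ, h0⟩
    refine h t Φ hΦ ?_
    let D := Proj.basicOpen (homogeneousSubmodule σ k) (X j)
    have e : ⊤ ≤ ι ⁻¹ᵁ D := by
      intro x _
      have : ι x ∈ ι.opensRange := ⟨x, rfl⟩
      rwa [Proj.opensRange_awayι] at this
    have e' : ⊤ ≤ (g ≫ ι) ⁻¹ᵁ D := fun x _ => e (Opens.mem_top (g x))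
    have h1 : Proj.awayToSection (homogeneousSubmodule σ k) (X j) ≫ (g ≫ ι).appLE D ⊤ e' =
        CommRingCat.ofHom q ≫ (Scheme.ΓSpecIso (CommRingCat.of B)).inv := by
      rw [← Scheme.Hom.appLE_comp_appLE g ι D ⊤ ⊤ e le_top, reassoc_of%
        (awayToSection_awayι_appLE j e), Scheme.ΓSpecIso_inv_naturality, Scheme.Hom.appTop,
        Scheme.Hom.app_eq_appLE]
      rfl
    have h2 := congr($(h1).hom (formFraction j Φ hΦ))
    have h3 : (Scheme.ΓSpecIso (CommRingCat.of B)).inv (q (formFraction j Φ hΦ)) = 0 := by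
      refine h2.symm.trans ?_
      change (Spec (CommRingCat.of B)).presheaf.map _ ((g ≫ ι).app D (formOnChart j Φ hΦ)) = 0
      exact (congrArg _ (h0 j)).trans (map_zero _)
    exact (map_eq_zero_iff _ (Scheme.ΓSpecIso
      (CommRingCat.of B)).symm.commRingCatIsoToRingEquiv.injective).mp h3
  · unfold schemeDegree
    rw [hstr]
    let := ((Scheme.ΓSpecIso (CommRingCat.of k)).inv ≫
      (Spec.map (CommRingCat.ofHom (algebraMap k B))).appTop).hom.toAlgebra
    let E := (Scheme.ΓSpecIso (CommRingCat.of B)).commRingCatIsoToRingEquiv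
    have hE (c : k) : E (algebraMap k _ c) = algebraMap k B c := by
      have h1 := Scheme.ΓSpecIso_inv_naturality (CommRingCat.ofHom (algebraMap k B))
      have h2 := congr($(h1).hom c)
      exact (congrArg E h2.symm).trans (E.apply_symm_apply _)
    exact ((AlgEquiv.ofRingEquiv (f := E) hE).toLinearEquiv).finrank_eq

/-- The cactus rank of a nonzero form is at most its apolar length. -/
theorem cactusRank_le_finrank (j : σ) {F : MvPolynomial σ k} {n : ℕ} (hF : F.IsHomogeneous n)
    (hF0 : F ≠ 0) [FiniteDimensional k (MvPolynomial σ k ⧸ apolarIdeal F)] :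
    cactusRank F ≤ Module.finrank k (MvPolynomial σ k ⧸ apolarIdeal F) := by
  obtain ⟨f, hf⟩ : ∃ f, f = dehomogenize j F := ⟨_, rfl⟩
  obtain ⟨q, hqdef⟩ : ∃ q, q = (Ideal.Quotient.mk (apolarIdeal f)).comp (chartDehomogenize j) :=
    ⟨_, rfl⟩
  have hqa (t : ℕ) (Φ : MvPolynomial σ k) (hΦ : Φ.IsHomogeneous t) :
      q (formFraction j Φ hΦ) = Ideal.Quotient.mk (apolarIdeal f) (dehomogenize j Φ) := by
    rw [hqdef, RingHom.comp_apply, chartDehomogenize_formFraction]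
  have hqk : q.comp (chartConst j) = algebraMap k (MvPolynomial σ k ⧸ apolarIdeal f) := by
    ext c
    rw [hqdef, RingHom.comp_apply, RingHom.comp_apply, chartDehomogenize_chartConst]
    rfl
  have hq : Function.Surjective q := by
    rw [← RingHom.range_eq_top, eq_top_iff]
    rintro x -
    obtain ⟨Φ, rfl⟩ := Ideal.Quotient.mk_surjective x
    induction Φ using MvPolynomial.induction_on with
    | C c => exact ⟨chartConst j c, congr($hqk c)⟩
    | add p q hp hq => rw [map_add]; exact add_mem hp hq
    | mul_X p i hp =>
      rw [map_mul]
      refine mul_mem hp ?_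
      -- The class of `y_j` is zero because `f` does not involve `x_j`; every other `y_i` is the
      -- image of `y_i / y_j`.
      by_cases hij : i = j
      · rw [hij, Ideal.Quotient.eq_zero_iff_mem.mpr
          (hf ▸ X_mem_apolarIdeal_dehomogenize j F)]
        exact zero_mem _
      · refine ⟨formFraction j (X i) (isHomogeneous_X k i), ?_⟩
        rw [hqa]
        simp [dehomogenize, hij]
  -- Modulo `Ann(f)` every operator is some `dehomogenize j Ψ`, and contraction by it commutes with
  -- dehomogenizing `F`.
  have hle : LinearMap.range (contractOn f) ≤
      (LinearMap.range (contractOn F)).map (dehomogenize j).toLinearMap := by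
    rintro _ ⟨Φ, rfl⟩
    obtain ⟨a, ha⟩ := hq (Ideal.Quotient.mk _ Φ)
    obtain ⟨t, Ψ, hΨ, rfl⟩ := formFraction_surjective j a
    rw [hqa] at ha
    have h1 : contractOn f Φ = contractOn f (dehomogenize j Ψ) := by
      have h2 := mem_apolarIdeal.mp (Ideal.Quotient.eq.mp ha.symm)
      rw [← contractOn_apply, map_sub] at h2
      exact sub_eq_zero.mp h2
    refine ⟨_, ⟨dehomogenize j Ψ, rfl⟩, ?_⟩
    rw [h1, hf]
    exact (contract_dehomogenize j Ψ F).symm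
  have hfin : FiniteDimensional k (LinearMap.range (contractOn F)) :=
    Module.Finite.equiv (quotientApolarEquiv F)
  have : FiniteDimensional k (LinearMap.range (contractOn f)) :=
    Submodule.finiteDimensional_of_le hle
  have : FiniteDimensional k (MvPolynomial σ k ⧸ apolarIdeal f) :=
    Module.Finite.equiv (quotientApolarEquiv f).symm
  have happ (t : ℕ) (Φ : MvPolynomial σ k) (hΦ : Φ.IsHomogeneous t)
      (h : q (formFraction j Φ hΦ) = 0) : Φ ∈ apolarIdeal F := by
    refine contract_eq_zero_of_dehomogenize j hF hΦ ?_
    rw [hqa] at h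
    rw [← hf]
    exact mem_apolarIdeal.mp (Ideal.Quotient.eq_zero_iff_mem.mp h)
  -- Otherwise the form `1` would be apolar to `F`, forcing `F = 0`.
  have : Nontrivial (MvPolynomial σ k ⧸ apolarIdeal f) := by
    rw [Ideal.Quotient.nontrivial_iff]
    intro htop
    refine hF0 ?_
    have h1 := happ 0 1 (isHomogeneous_one σ k) (by
      rw [hqa, Ideal.Quotient.eq_zero_iff_mem, htop]
      exact Submodule.mem_top)
    rwa [mem_apolarIdeal, map_one] at h1
  refine (iInf₂_le _ (finrank_mem_apolarDegrees j q hq hqk happ)).trans ?_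
  rw [Nat.cast_le, (quotientApolarEquiv f).finrank_eq, (quotientApolarEquiv F).finrank_eq]
  exact (Submodule.finrank_mono hle).trans (Submodule.finrank_map_le _ _)

end SchemeUpperBound

/-! ### Standard monomials in the exterior algebra -/

section Exterior

variable (k : Type u) [Field k] {N : ℕ}

/-- The exterior product of the standard basis vectors with indices `v 0, v 1, …`. -/
noncomputable def wedge {r : ℕ} (v : Fin r → Fin N) : ExteriorAlgebra k (Fin N → k) :=
  ExteriorAlgebra.ιMulti k r fun i => Pi.single (v i) 1

/-- The exterior product of the standard basis vectors with indices in `A`, in increasing order. -/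
noncomputable def wedgeFinset (A : Finset (Fin N)) : ExteriorAlgebra k (Fin N → k) :=
  wedge k (A.orderEmbOfFin rfl)

theorem wedge_mul {r s : ℕ} (v : Fin r → Fin N) (w : Fin s → Fin N) :
    wedge k v * wedge k w = wedge k (Fin.append v w) := by
  rw [wedge, wedge, ExteriorAlgebra.ιMulti_mul_ιMulti, wedge]
  congr 1
  ext i j
  refine Fin.addCases (fun a => ?_) (fun a => ?_) i <;> simp

theorem wedge_eq_zero {r : ℕ} {v : Fin r → Fin N} (hv : ¬ Function.Injective v) :
    wedge k v = 0 :=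
  ExteriorAlgebra.ιMulti_eq_zero_of_not_inj fun h => hv fun i j hij => h (by simp [hij])

theorem wedge_comp_perm {r : ℕ} (v : Fin r → Fin N) (τ : Equiv.Perm (Fin r)) :
    wedge k (v ∘ τ) = Equiv.Perm.sign τ • wedge k v :=
  AlternatingMap.map_perm (ExteriorAlgebra.ιMulti k r) (fun i => Pi.single (v i) 1) τ

/-- Sorting the factors costs only the sign of the sorting permutation. -/
theorem wedge_eq_wedgeFinset {r : ℕ} {v : Fin r → Fin N} (hv : Function.Injective v)
    {A : Finset (Fin N)} (hA : ∀ i, v i ∈ A) (hr : A.card = r) :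
    wedge k v = wedgeFinset k A ∨ wedge k v = -wedgeFinset k A := by
  subst hr
  let τ : Fin A.card → Fin A.card := fun i => (A.orderIsoOfFin rfl).symm ⟨v i, hA i⟩
  have hτ : Function.Injective τ := fun i j hij => hv (by simpa [τ] using hij)
  have h : v = A.orderEmbOfFin rfl ∘ Equiv.ofBijective τ (Finite.injective_iff_bijective.mp hτ) := by
    ext i
    simp [τ, ← Finset.coe_orderIsoOfFin_apply]
  rw [h, wedge_comp_perm]
  rcases Int.units_eq_one_or (Equiv.Perm.sign
    (Equiv.ofBijective τ (Finite.injective_iff_bijective.mp hτ))) with h | h <;> rw [h]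
  · left; rw [one_smul]; rfl
  · right; rw [Units.neg_smul, one_smul]; rfl

/-- The coefficient of the exterior product of all the standard basis vectors. -/
noncomputable def topCoeff : ExteriorAlgebra k (Fin N → k) →ₗ[k] k :=
  ExteriorAlgebra.liftAlternating fun r =>
    if h : r = N then h ▸ (Matrix.detRowAlternating : (Fin N → k) [⋀^Fin N]→ₗ[k] k) else 0

theorem topCoeff_wedge_of_ne {r : ℕ} (v : Fin r → Fin N) (hr : r ≠ N) :
    topCoeff k (wedge k v) = 0 := by
  rw [topCoeff, wedge, ExteriorAlgebra.liftAlternating_apply_ιMulti, dif_neg hr]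
  rfl

theorem topCoeff_wedge_perm (π : Equiv.Perm (Fin N)) :
    topCoeff k (wedge k π) = (Equiv.Perm.sign π : ℤ) := by
  have h := wedge_comp_perm k (N := N) id π
  rw [Function.id_comp] at h
  rw [h, Units.smul_def, map_zsmul, topCoeff, wedge, ExteriorAlgebra.liftAlternating_apply_ιMulti,
    dif_pos rfl]
  have : Matrix.det (fun i => (Pi.single (id i) 1 : Fin N → k)) = 1 := by
    rw [← Matrix.det_one (n := Fin N) (R := k)]
    refine congrArg Matrix.det (Matrix.ext fun i j => ?_)
    simp [Matrix.one_apply, Pi.single_apply, eq_comm]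
  change _ • Matrix.det _ = _
  rw [this]
  simp

theorem topCoeff_wedge_ne_zero_iff {r : ℕ} (v : Fin r → Fin N) :
    topCoeff k (wedge k v) ≠ 0 ↔ r = N ∧ Function.Injective v := by
  constructor
  · intro h
    refine ⟨by_contra fun hr => h (topCoeff_wedge_of_ne k v hr),
      by_contra fun hv => h (by rw [wedge_eq_zero k hv, map_zero])⟩
  · rintro ⟨rfl, hv⟩
    have := topCoeff_wedge_perm k (Equiv.ofBijective v (Finite.injective_iff_bijective.mp hv))
    rw [Equiv.coe_ofBijective] at this
    rw [this]
    rcases Int.units_eq_one_or (Equiv.Perm.sign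
      (Equiv.ofBijective v (Finite.injective_iff_bijective.mp hv))) with h | h <;> rw [h] <;> simp

theorem topCoeff_wedgeFinset_mul_ne_zero_iff (A B : Finset (Fin N)) :
    topCoeff k (wedgeFinset k A * wedgeFinset k B) ≠ 0 ↔ B = Aᶜ := by
  rw [wedgeFinset, wedgeFinset, wedge_mul, topCoeff_wedge_ne_zero_iff, Fin.append_injective_iff]
  have hdisj : (∀ (i : Fin A.card) (j : Fin B.card),
      A.orderEmbOfFin rfl i ≠ B.orderEmbOfFin rfl j) ↔ Disjoint A B := by
    rw [Finset.disjoint_left]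
    constructor
    · intro h x hA hB
      rw [← Finset.mem_coe, ← Finset.range_orderEmbOfFin _ rfl] at hA hB
      obtain ⟨i, rfl⟩ := hA
      obtain ⟨j, hj⟩ := hB
      exact h i j hj.symm
    · intro h i j hij
      exact h (Finset.orderEmbOfFin_mem A rfl i) (hij ▸ Finset.orderEmbOfFin_mem B rfl j)
  constructor
  · rintro ⟨hc, -, -, h⟩
    have hd := hdisj.mp h
    refine Finset.eq_of_subset_of_card_le (Finset.subset_compl_iff_disjoint_left.mpr hd) ?_
    rw [Finset.card_compl, Fintype.card_fin]
    omega
  · rintro rfl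
    refine ⟨?_, (A.orderEmbOfFin rfl).injective, (Aᶜ.orderEmbOfFin rfl).injective,
      hdisj.mpr disjoint_compl_right⟩
    rw [Finset.card_compl, Fintype.card_fin]
    have := Finset.card_le_univ A
    rw [Fintype.card_fin] at this
    omega

end Exterior

/-! ### The Pfaffian and the even exterior algebra -/

section PfaffianApolar

open MvPolynomial

variable (k : Type u) [Field k] {N : ℕ}

/-- The standard basis vector `e_i` in the exterior algebra. -/
noncomputable def extBasis (i : Fin N) : ExteriorAlgebra k (Fin N → k) :=
  ExteriorAlgebra.ι k (Pi.single i 1)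

/-- Moving a vector past two vectors changes the sign twice. Centrality is what permits a
homomorphism from a commutative polynomial ring. -/
theorem extBasis_mul_mem_center (i j : Fin N) :
    extBasis k i * extBasis k j ∈ Subalgebra.center k (ExteriorAlgebra k (Fin N → k)) := by
  rw [Subalgebra.mem_center_iff]
  intro x
  have hanti (v w : Fin N → k) : ExteriorAlgebra.ι k v * ExteriorAlgebra.ι k w =
      -(ExteriorAlgebra.ι k w * ExteriorAlgebra.ι k v) :=
    eq_neg_of_add_eq_zero_left (ExteriorAlgebra.ι_add_mul_swap v w)
  induction x using ExteriorAlgebra.induction with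
  | algebraMap r => exact Algebra.commutes r _
  | ι v =>
    rw [extBasis, extBasis, ← mul_assoc, hanti v, neg_mul, mul_assoc, hanti v, mul_neg, neg_neg,
      mul_assoc]
  | mul a b ha hb => rw [mul_assoc, hb, ← mul_assoc, ha, mul_assoc]
  | add a b ha hb => rw [add_mul, mul_add, ha, hb]

/-- The algebra homomorphism `y_ij ↦ e_i ∧ e_j`. -/
noncomputable def skewToExterior :
    MvPolynomial (SkewVar N) k →ₐ[k] ExteriorAlgebra k (Fin N → k) :=
  (Subalgebra.center k (ExteriorAlgebra k (Fin N → k))).val.comp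
    (aeval fun p : SkewVar N => ⟨extBasis k p.1.1 * extBasis k p.1.2,
      extBasis_mul_mem_center k p.1.1 p.1.2⟩)

theorem skewToExterior_X (p : SkewVar N) :
    skewToExterior k (X p) = extBasis k p.1.1 * extBasis k p.1.2 := by
  simp [skewToExterior]

/-- The sequence of the endpoints of a sequence of edges. -/
def flatten {d : ℕ} (p : Fin d → SkewVar N) (x : Fin (2 * d)) : Fin N :=
  if x.1 % 2 = 0 then (p ⟨x.1 / 2, by omega⟩).1.1 else (p ⟨x.1 / 2, by omega⟩).1.2

theorem flatten_two_mul {d : ℕ} (p : Fin d → SkewVar N) (i : Fin d) (h : 2 * i.1 < 2 * d) :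
    flatten p ⟨2 * i, h⟩ = (p i).1.1 := by
  simp [flatten]

theorem flatten_two_mul_add_one {d : ℕ} (p : Fin d → SkewVar N) (i : Fin d)
    (h : 2 * i.1 + 1 < 2 * d) : flatten p ⟨2 * i + 1, h⟩ = (p i).1.2 := by
  have h1 : (2 * i.1 + 1) % 2 = 1 := by omega
  have h2 : (2 * i.1 + 1) / 2 = i.1 := by omega
  simp [flatten, h1, h2]

theorem eq_flatten {d : ℕ} (p : Fin d → SkewVar N) (v : Fin (2 * d) → Fin N)
    (h0 : ∀ i : Fin d, v ⟨2 * i, by omega⟩ = (p i).1.1)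
    (h1 : ∀ i : Fin d, v ⟨2 * i + 1, by omega⟩ = (p i).1.2) : v = flatten p := by
  funext x
  rcases Nat.even_or_odd' x.1 with ⟨c, hc | hc⟩
  · have hx : x = ⟨2 * (⟨c, by omega⟩ : Fin d), by simp; omega⟩ := Fin.ext hc
    rw [hx, h0, flatten_two_mul]
  · have hx : x = ⟨2 * (⟨c, by omega⟩ : Fin d) + 1, by simp; omega⟩ := Fin.ext hc
    rw [hx, h1, flatten_two_mul_add_one]

theorem skewToExterior_prod {d : ℕ} (p : Fin d → SkewVar N) :
    skewToExterior k (∏ i, X (p i)) = wedge k (flatten p) := by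
  rw [← List.prod_ofFn, map_list_prod, List.map_ofFn, wedge, ExteriorAlgebra.ιMulti_apply,
    List.ofFn_mul', List.prod_flatten, List.map_ofFn]
  congr 2
  funext i
  simp only [Function.comp_apply, skewToExterior_X, List.ofFn_succ, List.ofFn_zero, List.prod_cons,
    List.prod_nil, mul_one]
  rw [extBasis, extBasis, ← flatten_two_mul p i (by omega),
    ← flatten_two_mul_add_one p i (by omega)]
  rfl

theorem exists_sum_single {σ : Type*} (m : σ →₀ ℕ) :
    ∃ (d : ℕ) (p : Fin d → σ), m = ∑ i, Finsupp.single (p i) 1 := by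
  induction m using Finsupp.induction_linear with
  | zero => exact ⟨0, Fin.elim0, by simp⟩
  | add f g hf hg =>
    obtain ⟨d, p, rfl⟩ := hf
    obtain ⟨e, q, rfl⟩ := hg
    exact ⟨d + e, Fin.append p q, by simp [Fin.sum_univ_add]⟩
  | single a n => exact ⟨n, fun _ => a, by simp⟩

theorem monomial_sum_single {σ : Type} {d : ℕ} (p : Fin d → σ) :
    (monomial (∑ i, Finsupp.single (p i) 1) 1 : MvPolynomial σ k) = ∏ i, X (p i) :=
  monomial_sum_one _ _

theorem skewToExterior_monomial (m : SkewVar N →₀ ℕ) :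
    skewToExterior k (monomial m 1) = 0 ∨ ∃ A : Finset (Fin N), Even A.card ∧
      (skewToExterior k (monomial m 1) = wedgeFinset k A ∨
        skewToExterior k (monomial m 1) = -wedgeFinset k A) := by
  obtain ⟨d, p, rfl⟩ := exists_sum_single m
  rw [monomial_sum_single, skewToExterior_prod]
  by_cases h : Function.Injective (flatten p)
  · right
    have hcard : (Finset.univ.image (flatten p)).card = 2 * d := by
      rw [Finset.card_image_of_injective _ h, Finset.card_univ, Fintype.card_fin]
    exact ⟨_, (congrArg Even hcard).mpr (even_two_mul d), wedge_eq_wedgeFinset k h (by simp) hcard⟩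
  · exact Or.inl (wedge_eq_zero k h)

theorem exists_skewToExterior_eq {A : Finset (Fin N)} (hA : Even A.card) :
    ∃ Φ, skewToExterior k Φ = wedgeFinset k A := by
  obtain ⟨d, hd⟩ := hA
  have hd : A.card = 2 * d := by omega
  let v := A.orderEmbOfFin hd
  let p : Fin d → SkewVar N := fun i => ⟨(v ⟨2 * i, by omega⟩, v ⟨2 * i + 1, by omega⟩),
    v.strictMono (by simp)⟩
  refine ⟨∏ i, X (p i), ?_⟩
  rw [skewToExterior_prod, ← eq_flatten p v (fun _ => rfl) (fun _ => rfl)]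
  have key : ∀ (r : ℕ) (h : A.card = r), wedge k (A.orderEmbOfFin h) = wedgeFinset k A := by
    rintro _ rfl; rfl
  exact key _ hd

theorem X_sq_skewToExterior (p : SkewVar N) : skewToExterior k (X p ^ 2) = 0 := by
  have h := skewToExterior_prod k (fun _ : Fin 2 => p)
  rw [Fin.prod_univ_two] at h
  rw [sq, h, wedge_eq_zero]
  intro hinj
  have := @hinj 0 2 rfl
  simp at this

/-- The edge joining the indices with numbers `2i` and `2i + 1`. -/
def pfaffianEdge {n : ℕ} {π : Equiv.Perm (Fin (2 * n))} (hπ : π ∈ pfaffianPerms n) (i : Fin n) :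
    SkewVar (2 * n) :=
  ⟨(π ⟨2 * i, by omega⟩, π ⟨2 * i + 1, by omega⟩), hπ.2 i⟩

theorem flatten_pfaffianEdge {n : ℕ} {π : Equiv.Perm (Fin (2 * n))} (hπ : π ∈ pfaffianPerms n) :
    flatten (pfaffianEdge hπ) = π :=
  (eq_flatten _ _ (fun _ => rfl) (fun _ => rfl)).symm

theorem sum_single_apply_ne_zero {σ : Type*} {d : ℕ} (p : Fin d → σ) (q : σ) :
    (∑ i, Finsupp.single (p i) 1 : σ →₀ ℕ) q ≠ 0 ↔ q ∈ Set.range p := by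
  classical
  rw [Finsupp.finsetSum_apply, ne_eq, Finset.sum_eq_zero_iff]
  simp [Finsupp.single_apply]

/-- The monomial determines the set of edges. Listing smaller endpoints increasingly fixes the order
of the edges, hence the permutation, so distinct terms of the Pfaffian never merge. -/
theorem pfaffianEdge_sum_injective {n : ℕ} {π τ : Equiv.Perm (Fin (2 * n))}
    (hπ : π ∈ pfaffianPerms n) (hτ : τ ∈ pfaffianPerms n)
    (h : ∑ i, Finsupp.single (pfaffianEdge hπ i) 1 =
      (∑ i, Finsupp.single (pfaffianEdge hτ i) 1 : SkewVar (2 * n) →₀ ℕ)) : π = τ := by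
  have hrange : Set.range (pfaffianEdge hπ) = Set.range (pfaffianEdge hτ) := by
    ext q
    rw [← sum_single_apply_ne_zero, h, sum_single_apply_ne_zero]
  have hfst : (fun i => (pfaffianEdge hπ i).1.1) = fun i => (pfaffianEdge hτ i).1.1 := by
    have h1 : StrictMono fun i => (pfaffianEdge hπ i).1.1 := fun i j hij => hπ.1 i j hij
    have h2 : StrictMono fun i => (pfaffianEdge hτ i).1.1 := fun i j hij => hτ.1 i j hij
    refine (StrictMono.range_inj h1 h2).mp ?_
    have := congrArg (Set.image fun q : SkewVar (2 * n) => q.1.1) hrange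
    rwa [← Set.range_comp, ← Set.range_comp] at this
  have hinj : Function.Injective fun i => (pfaffianEdge hτ i).1.1 :=
    StrictMono.injective fun i j hij => hτ.1 i j hij
  have hedge : pfaffianEdge hπ = pfaffianEdge hτ := by
    funext i
    obtain ⟨j, hj⟩ : pfaffianEdge hπ i ∈ Set.range (pfaffianEdge hτ) := hrange ▸ ⟨i, rfl⟩
    have : j = i := hinj (by
      change (pfaffianEdge hτ j).1.1 = (pfaffianEdge hτ i).1.1
      rw [hj]; exact congrFun hfst i)
    rw [← hj, this]
  have hfun : (π : Fin (2 * n) → Fin (2 * n)) = τ := by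
    rw [← flatten_pfaffianEdge hπ, ← flatten_pfaffianEdge hτ, hedge]
  exact Equiv.coe_fn_injective hfun

/-- A nonzero top coefficient means that the edges of `m` use each of the `2n` indices exactly once,
i.e. form a perfect matching. -/
theorem exists_pfaffianPerm {n : ℕ} {m : SkewVar (2 * n) →₀ ℕ}
    (hm : topCoeff k (skewToExterior k (monomial m 1)) ≠ 0) :
    ∃ (π : Equiv.Perm (Fin (2 * n))) (hπ : π ∈ pfaffianPerms n),
      m = ∑ i, Finsupp.single (pfaffianEdge hπ i) 1 := by
  obtain ⟨d, p, rfl⟩ := exists_sum_single m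
  have hd : d = n := by
    rw [monomial_sum_single, skewToExterior_prod, topCoeff_wedge_ne_zero_iff] at hm
    omega
  subst hd
  -- Reordering the edges by smaller endpoint leaves `m` unchanged and achieves the normalization in
  -- `pfaffianPerms`.
  let τ := Tuple.sort fun i => (p i).1.1
  let q := p ∘ τ
  have hq : (∑ i, Finsupp.single (p i) 1 : SkewVar (2 * d) →₀ ℕ) =
      ∑ i, Finsupp.single (q i) 1 := (Equiv.sum_comp τ _).symm
  rw [hq, monomial_sum_single, skewToExterior_prod, topCoeff_wedge_ne_zero_iff] at hm
  have hmono : Monotone fun i => (q i).1.1 := Tuple.monotone_sort fun i => (p i).1.1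
  have hinj := hm.2
  have hstrict : StrictMono fun i => (q i).1.1 := by
    refine hmono.strictMono_of_injective fun i j hij => ?_
    have h1 : flatten q ⟨2 * i, by omega⟩ = flatten q ⟨2 * j, by omega⟩ := by
      rw [flatten_two_mul, flatten_two_mul]; exact hij
    have h2 := congrArg Fin.val (hinj h1)
    ext
    simpa using h2
  let π := Equiv.ofBijective (flatten q) (Finite.injective_iff_bijective.mp hinj)
  have h0 (i : Fin d) : π ⟨2 * i, by omega⟩ = (q i).1.1 := flatten_two_mul q i _
  have h1 (i : Fin d) : π ⟨2 * i + 1, by omega⟩ = (q i).1.2 := flatten_two_mul_add_one q i _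
  have hπ : π ∈ pfaffianPerms d :=
    ⟨fun i j hij => by rw [h0, h0]; exact hstrict hij, fun i => by rw [h0, h1]; exact (q i).2⟩
  refine ⟨π, hπ, hq.trans (Finset.sum_congr rfl fun i _ => ?_)⟩
  congr 1
  exact Subtype.ext (Prod.ext (h0 i).symm (h1 i).symm)

/-- Both sides vanish unless `m` is a perfect matching; then exactly one permutation contributes,
with its sign on both sides. -/
theorem coeff_pfaffian {n : ℕ} (m : SkewVar (2 * n) →₀ ℕ) :
    coeff m (pfaffian (genericSkew k (2 * n))) =
      topCoeff k (skewToExterior k (monomial m 1)) := by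
  classical
  have hterm (π : Equiv.Perm (Fin (2 * n))) (hπ : π ∈ pfaffianPerms n) :
      coeff m (((Equiv.Perm.sign π : ℤ) : MvPolynomial (SkewVar (2 * n)) k) *
        ∏ i : Fin n, genericSkew k (2 * n) (π ⟨2 * i, by omega⟩) (π ⟨2 * i + 1, by omega⟩)) =
      if ∑ i, Finsupp.single (pfaffianEdge hπ i) 1 = m then
        topCoeff k (skewToExterior k (monomial m 1)) else 0 := by
    have h1 : ∏ i : Fin n, genericSkew k (2 * n) (π ⟨2 * i, by omega⟩) (π ⟨2 * i + 1, by omega⟩) =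
        monomial (∑ i, Finsupp.single (pfaffianEdge hπ i) 1) 1 := by
      rw [monomial_sum_single]
      refine Finset.prod_congr rfl fun i _ => ?_
      rw [genericSkew, dif_pos (hπ.2 i)]
      rfl
    rw [h1, ← map_intCast (C : k →+* MvPolynomial (SkewVar (2 * n)) k), coeff_C_mul, coeff_monomial]
    split_ifs with h
    · rw [← h, monomial_sum_single, skewToExterior_prod, flatten_pfaffianEdge, topCoeff_wedge_perm,
        mul_one]
    · rw [mul_zero]
  rw [pfaffian, coeff_sum]
  by_cases hm : topCoeff k (skewToExterior k (monomial m 1)) = 0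
  · rw [hm]
    refine Finset.sum_eq_zero fun π hπ => ?_
    rw [hterm π (Finset.mem_filter.mp hπ).2, hm, ite_self]
  · obtain ⟨π, hπ, h⟩ := exists_pfaffianPerm k hm
    rw [Finset.sum_eq_single_of_mem π (Finset.mem_filter.mpr ⟨Finset.mem_univ _, hπ⟩),
      hterm π hπ, if_pos h.symm]
    intro τ hτ hne
    have hτ := (Finset.mem_filter.mp hτ).2
    rw [hterm τ hτ, if_neg]
    exact fun h' => hne (pfaffianEdge_sum_injective hτ hπ (h'.trans h))

theorem coeff_contract_pfaffian {n : ℕ} (Φ : MvPolynomial (SkewVar (2 * n)) k)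
    (b : SkewVar (2 * n) →₀ ℕ) :
    coeff b (contract Φ (pfaffian (genericSkew k (2 * n)))) =
      topCoeff k (skewToExterior k Φ * skewToExterior k (monomial b 1)) := by
  induction Φ using MvPolynomial.induction_on' with
  | add p q hp hq => rw [map_add, LinearMap.add_apply, coeff_add, hp, hq, map_add, add_mul, map_add]
  | monomial a c =>
    rw [coeff_contract_monomial, coeff_pfaffian, ← map_mul, monomial_mul, mul_one,
      ← mul_one c, ← smul_eq_mul c 1, ← smul_monomial, map_smul, map_smul]
    simp only [smul_eq_mul, mul_one]

/-- The pairings of `θ(Φ)` with the basis of the even part of the exterior algebra. -/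
noncomputable def evenPairing : MvPolynomial (SkewVar N) k →ₗ[k]
    ({A : Finset (Fin N) // Even A.card} → k) :=
  LinearMap.pi fun A => topCoeff k ∘ₗ LinearMap.mulRight k (wedgeFinset k A.1) ∘ₗ
    (skewToExterior k).toLinearMap

theorem evenPairing_apply (Φ : MvPolynomial (SkewVar N) k)
    (A : {A : Finset (Fin N) // Even A.card}) :
    evenPairing k Φ A = topCoeff k (skewToExterior k Φ * wedgeFinset k A.1) := rfl

/-- Images of monomials are zero or `± e_A` with `|A|` even, and every such `e_A` is an image, so
testing against monomials or against the `e_A` is the same. -/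
theorem ker_evenPairing {n : ℕ} : LinearMap.ker (evenPairing k (N := 2 * n)) =
    LinearMap.ker (contractOn (pfaffian (genericSkew k (2 * n)))) := by
  ext Φ
  rw [LinearMap.mem_ker, LinearMap.mem_ker, contractOn_apply]
  constructor
  · intro h
    have h (A : Finset (Fin (2 * n))) (hA : Even A.card) :
        topCoeff k (skewToExterior k Φ * wedgeFinset k A) = 0 := congrFun h ⟨A, hA⟩
    ext b
    rw [coeff_contract_pfaffian, coeff_zero]
    rcases skewToExterior_monomial k b with hb | ⟨A, hA, hb | hb⟩
    · rw [hb, mul_zero, map_zero]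
    · rw [hb, h A hA]
    · rw [hb, mul_neg, map_neg, h A hA, neg_zero]
  · intro h
    funext ⟨A, hA⟩
    rw [evenPairing_apply, Pi.zero_apply]
    obtain ⟨Ψ, hΨ⟩ := exists_skewToExterior_eq k hA
    rw [← hΨ]
    clear hΨ
    induction Ψ using MvPolynomial.induction_on' with
    | add p q hp hq => rw [map_add, mul_add, map_add, hp, hq, add_zero]
    | monomial a c =>
      rw [← mul_one c, ← smul_eq_mul c 1, ← smul_monomial, map_smul, mul_smul_comm, map_smul,
        ← coeff_contract_pfaffian, h, coeff_zero, smul_zero]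

/-- As `N` is even, complements of even sets are even, and `e_{Aᶜ}` is up to a nonzero scalar dual
to `e_A`. -/
theorem evenPairing_surjective (hN : Even N) : Function.Surjective (evenPairing k (N := N)) := by
  classical
  rw [← LinearMap.range_eq_top, eq_top_iff, ← (Pi.basisFun k _).span_eq, Submodule.span_le]
  rintro _ ⟨A, rfl⟩
  have hA : Even (A.1ᶜ).card := by
    rw [Finset.card_compl, Fintype.card_fin, Nat.even_sub (by simpa using Finset.card_le_univ A.1)]
    exact iff_of_true hN A.2
  obtain ⟨Φ, hΦ⟩ := exists_skewToExterior_eq k hA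
  have h0 : topCoeff k (wedgeFinset k A.1ᶜ * wedgeFinset k A.1) ≠ 0 :=
    (topCoeff_wedgeFinset_mul_ne_zero_iff k _ _).mpr (compl_compl _).symm
  refine ⟨(topCoeff k (wedgeFinset k A.1ᶜ * wedgeFinset k A.1))⁻¹ • Φ, ?_⟩
  funext B
  rw [map_smul, Pi.smul_apply, evenPairing_apply, hΦ, Pi.basisFun_apply, smul_eq_mul,
    Pi.single_apply]
  split_ifs with hB
  · rw [hB, inv_mul_cancel₀ h0]
  · rw [not_not.mp fun h => hB (Subtype.ext
      (((topCoeff_wedgeFinset_mul_ne_zero_iff k _ _).mp h).trans (compl_compl _))), mul_zero]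

theorem card_even_finset (hN : 0 < N) :
    Fintype.card {A : Finset (Fin N) // Even A.card} = 2 ^ (N - 1) := by
  have h1 : ∑ A : Finset (Fin N), (-1 : ℤ) ^ A.card = 0 := by
    have : Nonempty (Fin N) := ⟨⟨0, hN⟩⟩
    simpa using Finset.sum_powerset_neg_one_pow_card_of_nonempty
      (Finset.univ_nonempty (α := Fin N))
  have h2 : ∑ A : Finset (Fin N), (1 + (-1 : ℤ) ^ A.card) = 2 ^ N := by
    rw [Finset.sum_add_distrib, h1]
    simp
  have h3 (A : Finset (Fin N)) : (1 + (-1 : ℤ) ^ A.card) = if Even A.card then 2 else 0 := by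
    split_ifs with h
    · rw [h.neg_one_pow]; rfl
    · rw [(Nat.not_even_iff_odd.mp h).neg_one_pow]; rfl
  simp only [h3, ← Finset.sum_filter, Finset.sum_const, nsmul_eq_mul] at h2
  rw [Fintype.card_subtype]
  obtain ⟨M, rfl⟩ : ∃ M, N = M + 1 := ⟨N - 1, by omega⟩
  rw [pow_succ] at h2
  exact_mod_cast mul_right_cancel₀ two_ne_zero h2

theorem finrank_quotient_apolarIdeal_pfaffian {n : ℕ} (hn : 1 ≤ n) :
    Module.finrank k (MvPolynomial (SkewVar (2 * n)) k ⧸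
      apolarIdeal (pfaffian (genericSkew k (2 * n)))) = 2 ^ (2 * n - 1) := by
  rw [← card_even_finset (by omega), ← Module.finrank_pi k, (quotientApolarEquiv _).finrank_eq,
    ← ((contractOn _).quotKerEquivRange).finrank_eq, ← ker_evenPairing,
    ((evenPairing k).quotKerEquivOfSurjective
      (evenPairing_surjective k (even_two_mul n))).finrank_eq]

theorem X_sq_mem_apolarIdeal_pfaffian {n : ℕ} (p : SkewVar (2 * n)) :
    (X p ^ 2 : MvPolynomial (SkewVar (2 * n)) k) ∈
      apolarIdeal (pfaffian (genericSkew k (2 * n))) := by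
  rw [mem_apolarIdeal]
  ext b
  rw [coeff_contract_pfaffian, X_sq_skewToExterior, zero_mul, map_zero, coeff_zero]

theorem pfaffian_isHomogeneous {n : ℕ} : (pfaffian (genericSkew k (2 * n))).IsHomogeneous n := by
  intro m hm
  rw [coeff_pfaffian] at hm
  obtain ⟨π, hπ, rfl⟩ := exists_pfaffianPerm k hm
  rw [map_sum]
  simp [Finsupp.weight_apply]

end PfaffianApolar

theorem corollary4p12 (k : Type u) [Field k] (hk : ringChar k ≠ 2) (n : ℕ) (hn : 1 ≤ n) :
    Module.finrank k (MvPolynomial (SkewVar (2 * n)) k ⧸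
        apolarIdeal (pfaffian (genericSkew k (2 * n)))) = 2 ^ (2 * n - 1) ∧
      (2 : ℕ∞) ^ (2 * n - 2) ≤ cactusRank (pfaffian (genericSkew k (2 * n))) ∧
      cactusRank (pfaffian (genericSkew k (2 * n))) ≤ (2 : ℕ∞) ^ (2 * n - 1) := by
  have hlen := finrank_quotient_apolarIdeal_pfaffian k hn
  refine ⟨hlen, le_iInf₂ fun d hd => ?_, ?_⟩
  · have h := finrank_le_two_mul_of_mem_apolarDegrees (X_sq_mem_apolarIdeal_pfaffian k) hd
    rw [hlen, show 2 * n - 1 = (2 * n - 2) + 1 by omega, pow_succ'] at h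
    exact_mod_cast Nat.le_of_mul_le_mul_left h two_pos
  · have hpos : 0 < Module.finrank k (MvPolynomial (SkewVar (2 * n)) k ⧸
        apolarIdeal (pfaffian (genericSkew k (2 * n)))) := hlen ▸ pow_pos two_pos _
    -- `finrank` is zero on infinite-dimensional spaces, so the positive value computed above yields
    -- finite-dimensionality.
    have := Module.finite_of_finrank_pos hpos
    have hne : pfaffian (genericSkew k (2 * n)) ≠ 0 := by
      intro h0
      have := Module.finrank_pos_iff.mp hpos
      rw [Ideal.Quotient.nontrivial_iff] at this
      exact this ((Ideal.eq_top_iff_one _).mpr (by rw [mem_apolarIdeal, h0, map_zero]))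
    have h := cactusRank_le_finrank (⟨(⟨0, by omega⟩, ⟨1, by omega⟩), by simp⟩ : SkewVar (2 * n))
      (pfaffian_isHomogeneous k) hne
    rw [hlen] at h
    exact_mod_cast h
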